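/- There is a universal constant $C>0$ with the following property. Let $\mathbb T=\mathbb R/\mathbb Z$ carry its quotient distance $|\cdot|$ and normalized Lebesgue measure (used for all $L^p$ norms below). For a complex Borel measure $\mu$ on $\mathbb T$ let $\|\mu\|=|\mu|(\mathbb T)$ be its total variation norm, let $\hat\mu(m)=\int_{\mathbb T}e^{-2\pi i m x}\,d\mu(x)$ for $m\in\mathbb Z$, and for an integer $M>0$ let $P_M\mu(x)=\sum_{m=-M}^{M}\hat\mu(m)e^{2\pi i m x}$. Let $M\ge 128$ be an integer and $\epsilon\ge 0$. Let $\mu_0=\sum_{j=1}^{J}a_j\delta_{s_j}$ be a discrete complex measure ($J\ge 0$, $a_j\in\mathbb C\setminus\{0\}$, $s_j\in\mathbb T$ distinct) whose support satisfies $|s_j-s_k|\ge 2/M$ for all $j\ne k$, and let $\mu$ be a complex Borel measure on $\mathbb T$ such that \[ \|\mu\|\le\|\mu_0\|+2\epsilon\qquad\text{and}\qquad \|P_M(\mu-\mu_0)\|_{L^2(\mathbb T)}\le 2\epsilon . \] Then for every twice differentiable function $K:\mathbb T\to\mathbb C$ with $K''\in L^\infty(\mathbb T)$, the convolution $K*(\mu-\mu_0)(x)=\int_{\mathbb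 T}K(x-y)\,d(\mu-\mu_0)(y)$ satisfies \[ \|K*(\mu-\mu_0)\|_{L^\infty}\le C\,\epsilon\,\bigl(\|K\|_{L^\infty}+M^{-1}\|K'\|_{L^\infty}+M^{-2}\|K''\|_{L^\infty}\bigr). \] -/

import Mathlib

open MeasureTheory
open scoped ENNReal NNReal

noncomputable section

namespace SuperResolution

/-- The torus `𝕋 = ℝ / ℤ`, with its quotient distance and its Haar (= Lebesgue) probability
measure `volume`. -/
abbrev Torus : Type := AddCircle (1 : ℝ)

/-- The integral `∫ f dμ` of a complex function against a complex Borel measure on the torus. -/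
def cintegral (μ : ComplexMeasure Torus) (f : Torus → ℂ) : ℂ :=
  VectorMeasure.integral μ f (ContinuousLinearMap.mul ℝ ℂ)

/-- The total variation norm `‖μ‖ = |μ|(𝕋)`. -/
def tvNorm (μ : ComplexMeasure Torus) : ℝ≥0∞ :=
  VectorMeasure.variation μ Set.univ

/-- The Fourier coefficient `μ̂(m) = ∫ exp(-2πimx) dμ(x)`. -/
def fourierCoeffMeasure (μ : ComplexMeasure Torus) (m : ℤ) : ℂ :=
  cintegral μ (fun x => fourier (-m) x)

/-- The projection `P_M μ(x) = ∑_{m=-M}^{M} μ̂(m) exp(2πimx)`. -/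
def proj (M : ℕ) (μ : ComplexMeasure Torus) (x : Torus) : ℂ :=
  ∑ m ∈ Finset.Icc (-(M : ℤ)) (M : ℤ), fourierCoeffMeasure μ m * fourier m x

/-- Minimum separation: distinct points of `S` are at distance at least `2 / M` on the torus. -/
def MinSeparation (M : ℕ) (S : Finset Torus) : Prop :=
  ∀ s ∈ S, ∀ t ∈ S, s ≠ t → 2 / (M : ℝ) ≤ dist s t

/-- Discrete measures `∑_{s ∈ S} a_s δ_s`, all `a_s ≠ 0`, whose support `S` satisfies the minimum
separation condition. -/
def IsSeparatedDiscrete (M : ℕ) (μ : ComplexMeasure Torus) : Prop :=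
  ∃ (S : Finset Torus) (a : Torus → ℂ), MinSeparation M S ∧ (∀ s ∈ S, a s ≠ 0) ∧
    μ = ∑ s ∈ S, VectorMeasure.dirac s (a s)

/-- `μ` is an `(ε, Λ_M)`-approximation of `μ₀`:
`‖μ‖ ≤ ‖μ₀‖ + 2ε` and `‖P_M(μ - μ₀)‖_{L²} ≤ 2ε`. -/
def IsApproximation (ε : ℝ≥0) (M : ℕ) (μ μ₀ : ComplexMeasure Torus) : Prop :=
  tvNorm μ ≤ tvNorm μ₀ + 2 * (ε : ℝ≥0∞) ∧
    eLpNorm (proj M (μ - μ₀)) 2 volume ≤ 2 * (ε : ℝ≥0∞)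

/-- `K` is differentiable at every point of the torus. -/
def TorusDifferentiable (K : Torus → ℂ) : Prop :=
  ∀ x : Torus, DifferentiableAt ℝ (fun t : ℝ => K (x + (t : Torus))) 0

/-- The derivative `K'` of a function on the torus. -/
def torusDeriv (K : Torus → ℂ) (x : Torus) : ℂ :=
  deriv (fun t : ℝ => K (x + (t : Torus))) 0

/-- The convolution `(K * ν)(x) = ∫ K(x - y) dν(y)`. -/
def conv (K : Torus → ℂ) (ν : ComplexMeasure Torus) (x : Torus) : ℂ :=
  cintegral ν (fun y => K (x - y))

end SuperResolution

end

noncomputable section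

namespace SuperResolution

/-! ### Integration against complex measures -/

lemma norm_cintegral_le (μ : ComplexMeasure Torus) (f : Torus → ℂ) :
    ‖cintegral μ f‖ ≤ ∫ x, ‖f x‖ ∂μ.variation := by
  have h := VectorMeasure.norm_integral_le_integral_norm (μ := μ) (f := f)
    (B := ContinuousLinearMap.mul ℝ ℂ)
  rwa [ContinuousLinearMap.opNorm_mul, one_mul] at h

lemma integrable_of_continuous (μ : Measure Torus) [IsFiniteMeasure μ] {E : Type*}
    [NormedAddCommGroup E] {f : Torus → E} (hf : Continuous f) : Integrable f μ :=
  hf.integrable_of_hasCompactSupport (HasCompactSupport.of_compactSpace f)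

lemma cintegral_add (μ : ComplexMeasure Torus) [IsFiniteMeasure μ.variation] {f g : Torus → ℂ}
    (hf : Continuous f) (hg : Continuous g) :
    cintegral μ (f + g) = cintegral μ f + cintegral μ g :=
  VectorMeasure.integral_add (integrable_of_continuous _ hf) (integrable_of_continuous _ hg)

lemma cintegral_sub (μ : ComplexMeasure Torus) [IsFiniteMeasure μ.variation] {f g : Torus → ℂ}
    (hf : Continuous f) (hg : Continuous g) :
    cintegral μ (f - g) = cintegral μ f - cintegral μ g :=
  VectorMeasure.integral_sub (integrable_of_continuous _ hf) (integrable_of_continuous _ hg)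

lemma cintegral_smul (μ : ComplexMeasure Torus) (c : ℂ) (f : Torus → ℂ) :
    cintegral μ (c • f) = c * cintegral μ f := by
  refine setToFun_smul _ (fun c s x => ?_) c f
  change c * x * _ = c * (x * _)
  rw [mul_assoc]

lemma cintegral_sub_measure (μ ν : ComplexMeasure Torus) [IsFiniteMeasure μ.variation]
    [IsFiniteMeasure ν.variation] {f : Torus → ℂ} (hf : Continuous f) :
    cintegral (μ - ν) f = cintegral μ f - cintegral ν f :=
  VectorMeasure.integral_sub_vectorMeasure (integrable_of_continuous _ hf)
    (integrable_of_continuous _ hf)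

lemma cintegral_sum_dirac (S : Finset Torus) (a : Torus → ℂ) {f : Torus → ℂ}
    (hf : Continuous f) :
    cintegral (∑ s ∈ S, VectorMeasure.dirac s (a s)) f = ∑ s ∈ S, f s * a s := by
  rw [cintegral, VectorMeasure.integral_finsetSum_vectorMeasure
    (fun s _ => integrable_of_continuous _ hf)]
  simp

lemma tvNorm_sum_dirac_le (S : Finset Torus) (a : Torus → ℂ) :
    tvNorm (∑ s ∈ S, VectorMeasure.dirac s (a s)) ≤ ENNReal.ofReal (∑ s ∈ S, ‖a s‖) := by
  refine (VectorMeasure.variation_finsetSum_le S _ _).trans ?_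
  rw [ENNReal.ofReal_sum_of_nonneg (fun _ _ => norm_nonneg _)]
  simp

/-! ### Trigonometric polynomials -/

/-- Trigonometric polynomials of degree at most `n` on the torus. -/
def trigPoly (n : ℕ) : Submodule ℂ (Torus → ℂ) :=
  Submodule.span ℂ {g | ∃ m : ℤ, |m| ≤ n ∧ g = fun x => fourier m x}

lemma fourier_mem_trigPoly {n : ℕ} {m : ℤ} (hm : |m| ≤ n) :
    (fun x : Torus => (fourier m x : ℂ)) ∈ trigPoly n :=
  Submodule.subset_span ⟨m, hm, rfl⟩

lemma continuous_of_mem_trigPoly {n : ℕ} {f : Torus → ℂ} (hf : f ∈ trigPoly n) :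
    Continuous f := by
  induction hf using Submodule.span_induction with
  | mem g hg => obtain ⟨m, -, rfl⟩ := hg; exact (fourier m).continuous
  | zero => exact continuous_const
  | add f g _ _ hf hg => exact hf.add hg
  | smul c f _ hf => exact hf.const_smul c

lemma trigPoly_mono {m n : ℕ} (h : m ≤ n) : trigPoly m ≤ trigPoly n :=
  Submodule.span_mono fun _ ⟨k, hk, hg⟩ => ⟨k, hk.trans (by exact_mod_cast h), hg⟩

lemma mul_mem_trigPoly {m n : ℕ} {f g : Torus → ℂ} (hf : f ∈ trigPoly m) (hg : g ∈ trigPoly n) :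
    f * g ∈ trigPoly (m + n) := by
  have h := Submodule.mul_mem_mul hf hg
  rw [trigPoly, trigPoly, Submodule.span_mul_span] at h
  refine Submodule.span_mono ?_ h
  rintro _ ⟨_, ⟨k, hk, rfl⟩, _, ⟨l, hl, rfl⟩, rfl⟩
  refine ⟨k + l, ?_, ?_⟩
  · push_cast
    exact (abs_add_le k l).trans (add_le_add hk hl)
  · ext x
    exact (fourier_add (m := k) (n := l)).symm

lemma comp_sub_mem_trigPoly {n : ℕ} {f : Torus → ℂ} (hf : f ∈ trigPoly n) (s : Torus) :
    (fun x => f (x - s)) ∈ trigPoly n := by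
  induction hf using Submodule.span_induction with
  | mem g hg =>
    obtain ⟨m, hm, rfl⟩ := hg
    have : (fun x : Torus => (fourier m (x - s) : ℂ))
        = (fourier m (-s) : ℂ) • fun x : Torus => (fourier m x : ℂ) := by
      ext x
      simp only [Pi.smul_apply, smul_eq_mul, sub_eq_add_neg, fourier_apply, smul_add,
        AddCircle.toCircle_add, Circle.coe_mul]
      ring
    rw [this]
    exact Submodule.smul_mem _ _ (fourier_mem_trigPoly hm)
  | zero => exact Submodule.zero_mem _
  | add f g _ _ hf hg => exact Submodule.add_mem _ hf hg
  | smul c f _ hf => exact Submodule.smul_mem _ c hf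

lemma continuous_proj (M : ℕ) (ν : ComplexMeasure Torus) : Continuous (proj M ν) := by
  unfold proj
  exact continuous_finsetSum _ fun m _ => continuous_const.mul (fourier m).continuous

lemma integral_fourier_mul_proj {M : ℕ} (ν : ComplexMeasure Torus) {m : ℤ} (hm : |m| ≤ M) :
    ∫ x : Torus, (fourier m x : ℂ) * proj M ν x = fourierCoeffMeasure ν (-m) := by
  have h1 : ∀ x : Torus, (fourier m x : ℂ) * proj M ν x
      = ∑ k ∈ Finset.Icc (-(M : ℤ)) M, fourierCoeffMeasure ν k * (fourier (m + k) x : ℂ) := by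
    intro x
    rw [proj, Finset.mul_sum]
    refine Finset.sum_congr rfl fun k _ => ?_
    rw [fourier_add]; ring
  simp_rw [h1]
  rw [integral_finsetSum _ fun k _ => (integrable_of_continuous volume
    (fourier (T := (1 : ℝ)) (m + k)).continuous).const_mul (fourierCoeffMeasure ν k)]
  have h2 : ∀ k : ℤ, ∫ x : Torus, fourierCoeffMeasure ν k * (fourier (m + k) x : ℂ)
      = if k = -m then fourierCoeffMeasure ν k else 0 := by
    intro k
    rw [integral_const_mul]
    have h3 := fourierCoeff_fourier (T := (1 : ℝ)) (m + k)
    have h4 := congrFun h3 0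
    rw [fourierCoeff] at h4
    simp only [neg_zero, fourier_zero, one_smul] at h4
    have h5 : ∫ x : Torus, (fourier (m + k) x : ℂ)
        = ∫ x : Torus, (fourier (m + k) x : ℂ) ∂AddCircle.haarAddCircle := by
      rw [AddCircle.volume_eq_smul_haarAddCircle]; simp
    rw [h5, h4, Pi.single_apply]
    by_cases hk : k = -m
    · simp [hk]
    · rw [if_neg hk, if_neg (by omega)]; simp
  simp_rw [h2]
  rw [Finset.sum_ite_eq' ]
  rw [if_pos]
  rw [abs_le] at hm
  simp only [Finset.mem_Icc]; omega

lemma cintegral_eq_integral_mul_proj {M : ℕ} (ν : ComplexMeasure Torus)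
    [IsFiniteMeasure ν.variation] {T : Torus → ℂ} (hT : T ∈ trigPoly M) :
    cintegral ν T = ∫ x, T x * proj M ν x := by
  induction hT using Submodule.span_induction with
  | mem g hg =>
    obtain ⟨m, hm, rfl⟩ := hg
    rw [integral_fourier_mul_proj ν hm, fourierCoeffMeasure, neg_neg]
  | zero =>
    have := cintegral_smul ν 0 0
    simp at this
    simp [this]
  | add f g hf hg h1 h2 =>
    have hf' := continuous_of_mem_trigPoly hf
    have hg' := continuous_of_mem_trigPoly hg
    have i1 := integrable_of_continuous volume (hf'.mul (continuous_proj M ν))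
    have i2 := integrable_of_continuous volume (hg'.mul (continuous_proj M ν))
    rw [cintegral_add ν hf' hg', h1, h2]
    refine (integral_add i1 i2).symm.trans ?_
    simp [add_mul]
  | smul c f hf h =>
    rw [cintegral_smul, h, ← integral_const_mul]
    simp [mul_assoc]

lemma norm_cintegral_trigPoly_le {M : ℕ} (ν : ComplexMeasure Torus)
    [IsFiniteMeasure ν.variation] {T : Torus → ℂ} (hT : T ∈ trigPoly M) {c : ℝ}
    (hc : ∀ x, ‖T x‖ ≤ c) {δ : ℝ≥0} (hδ : eLpNorm (proj M ν) 2 volume ≤ δ) :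
    ‖cintegral ν T‖ ≤ c * δ := by
  have hP := continuous_proj M ν
  have hc0 : 0 ≤ c := (norm_nonneg _).trans (hc 0)
  have : IsProbabilityMeasure (volume : Measure Torus) := ⟨by simp [AddCircle.measure_univ]⟩
  rw [cintegral_eq_integral_mul_proj ν hT]
  have h1 : eLpNorm (proj M ν) 1 volume ≤ δ :=
    (eLpNorm_le_eLpNorm_of_exponent_le (by norm_num) hP.aestronglyMeasurable).trans hδ
  have h2 : ∫ x, ‖proj M ν x‖ ≤ δ := by
    rw [integral_norm_eq_lintegral_enorm hP.aestronglyMeasurable,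
      ← eLpNorm_one_eq_lintegral_enorm]
    exact ENNReal.toReal_le_coe_of_le_coe h1
  calc ‖∫ x, T x * proj M ν x‖ ≤ ∫ x, ‖T x * proj M ν x‖ := norm_integral_le_integral_norm _
    _ ≤ ∫ x, c * ‖proj M ν x‖ := by
      refine integral_mono (integrable_of_continuous _
        ((continuous_of_mem_trigPoly hT).mul hP).norm)
        (integrable_of_continuous _ (continuous_const.mul hP.norm)) fun x => ?_
      simp only [norm_mul]
      exact mul_le_mul_of_nonneg_right (hc x) (norm_nonneg _)
    _ = c * ∫ x, ‖proj M ν x‖ := integral_const_mul _ _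
    _ ≤ c * δ := mul_le_mul_of_nonneg_left h2 hc0

/-- A dual certificate `f` together with a trigonometric polynomial `T` agreeing with `φ` on the
support controls the error of the integral of `φ`. -/
theorem norm_cintegral_sub_le_of_certificate {M : ℕ} {ε : ℝ≥0} {S : Finset Torus}
    {a : Torus → ℂ} {μ : ComplexMeasure Torus}
    (h : IsApproximation ε M μ (∑ s ∈ S, VectorMeasure.dirac s (a s)))
    {f T φ : Torus → ℂ} (hf : f ∈ trigPoly M) (hf1 : ∀ x, ‖f x‖ ≤ 1)
    (hfS : ∀ s ∈ S, f s * a s = ‖a s‖) (hT : T ∈ trigPoly M) {c d : ℝ}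
    (hc : ∀ x, ‖T x‖ ≤ c) (hφ : Continuous φ) (hφS : ∀ s ∈ S, φ s = T s) (hd : 0 ≤ d)
    (hφT : ∀ x, ‖φ x - T x‖ ≤ d * (1 - ‖f x‖)) :
    ‖cintegral (μ - ∑ s ∈ S, VectorMeasure.dirac s (a s)) φ‖ ≤ (2 * c + 4 * d) * ε := by
  set μ₀ : ComplexMeasure Torus := ∑ s ∈ S, VectorMeasure.dirac s (a s) with hμ₀
  obtain ⟨htv, hL2⟩ := h
  have htv0 : tvNorm μ₀ ≤ ENNReal.ofReal (∑ s ∈ S, ‖a s‖) := tvNorm_sum_dirac_le S a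
  have fin0 : IsFiniteMeasure μ₀.variation := ⟨htv0.trans_lt ENNReal.ofReal_lt_top⟩
  have htv1 : tvNorm μ ≤ ENNReal.ofReal (∑ s ∈ S, ‖a s‖ + 2 * ε) := by
    rw [ENNReal.ofReal_add (Finset.sum_nonneg fun _ _ => norm_nonneg _) (by positivity)]
    refine htv.trans (add_le_add htv0 ?_)
    rw [ENNReal.ofReal_mul (by norm_num)]
    simp
  have fin1 : IsFiniteMeasure μ.variation := ⟨htv1.trans_lt ENNReal.ofReal_lt_top⟩
  have fin2 : IsFiniteMeasure (μ - μ₀).variation :=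
    isFiniteMeasure_of_le _ VectorMeasure.variation_sub_le
  have hL2' : eLpNorm (proj M (μ - μ₀)) 2 volume ≤ ((2 * ε : ℝ≥0) : ℝ≥0∞) := by
    simpa using hL2
  have hfc := continuous_of_mem_trigPoly hf
  have hTc := continuous_of_mem_trigPoly hT
  have e1 : cintegral μ₀ f = ((∑ s ∈ S, ‖a s‖ : ℝ) : ℂ) := by
    rw [hμ₀, cintegral_sum_dirac S a hfc, Finset.sum_congr rfl hfS]; push_cast; rfl
  have e2 := norm_cintegral_trigPoly_le (μ - μ₀) hf hf1 hL2'
  rw [cintegral_sub_measure μ μ₀ hfc, e1] at e2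
  have e3 := norm_cintegral_le μ f
  have e4 : ∑ s ∈ S, ‖a s‖ - 2 * ε ≤ ∫ x, ‖f x‖ ∂μ.variation := by
    have t1 := norm_sub_norm_le ((∑ s ∈ S, ‖a s‖ : ℝ) : ℂ) (cintegral μ f)
    rw [norm_sub_rev, Complex.norm_real, Real.norm_of_nonneg
      (Finset.sum_nonneg fun _ _ => norm_nonneg _)] at t1
    push_cast at e2
    push_cast at t1
    linarith
  have e5 : μ.variation.real Set.univ ≤ ∑ s ∈ S, ‖a s‖ + 2 * ε :=
    ENNReal.toReal_le_of_le_ofReal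
      (add_nonneg (Finset.sum_nonneg fun _ _ => norm_nonneg _) (by positivity)) htv1
  have e6 : ∫ x, (1 - ‖f x‖) ∂μ.variation ≤ 4 * ε := by
    rw [integral_sub (integrable_const _) (integrable_of_continuous _ hfc.norm)]
    simp only [integral_const, smul_eq_mul, mul_one]
    linarith
  have e7 : ‖cintegral μ (φ - T)‖ ≤ d * (4 * ε) := by
    refine (norm_cintegral_le μ _).trans ?_
    calc ∫ x, ‖(φ - T) x‖ ∂μ.variation ≤ ∫ x, d * (1 - ‖f x‖) ∂μ.variation :=
          integral_mono (integrable_of_continuous _ (hφ.sub hTc).norm)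
            (integrable_of_continuous _ (continuous_const.mul (continuous_const.sub hfc.norm)))
            hφT
      _ = d * ∫ x, (1 - ‖f x‖) ∂μ.variation := integral_const_mul _ _
      _ ≤ _ := mul_le_mul_of_nonneg_left e6 hd
  have e8 : cintegral μ₀ (φ - T) = 0 := by
    rw [hμ₀, cintegral_sum_dirac S a (hφ.sub hTc)]
    exact Finset.sum_eq_zero fun s hs => by simp [hφS s hs]
  have e9 : cintegral (μ - μ₀) φ = cintegral μ (φ - T) + cintegral (μ - μ₀) T := by
    have : cintegral (μ - μ₀) (φ - T) = cintegral μ (φ - T) := by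
      rw [cintegral_sub_measure μ μ₀ (hφ.sub hTc), e8, sub_zero]
    rw [← this, cintegral_sub _ hφ hTc]; ring
  rw [e9]
  refine (norm_add_le _ _).trans ?_
  have e10 := norm_cintegral_trigPoly_le (μ - μ₀) hT hc hL2'
  push_cast at e10
  linarith

/-! ### The Dirichlet-type kernel and its derivatives -/

/-- The frequencies `π (2k + 1 - N) / N` of the normalized Dirichlet kernel. -/
def dirFreq (N k : ℕ) : ℝ := Real.pi * (2 * k + 1 - N) / N

/-- The normalized Dirichlet kernel `sin (π t) / (N sin (π t / N))`. -/
def dir (N : ℕ) (t : ℝ) : ℝ := (∑ k ∈ Finset.range N, Real.cos (dirFreq N k * t)) / N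

/-- The derivative of `dir`. -/
def dir' (N : ℕ) (t : ℝ) : ℝ :=
  (∑ k ∈ Finset.range N, -(dirFreq N k * Real.sin (dirFreq N k * t))) / N

/-- The second derivative of `dir`. -/
def dir'' (N : ℕ) (t : ℝ) : ℝ :=
  (∑ k ∈ Finset.range N, -(dirFreq N k ^ 2 * Real.cos (dirFreq N k * t))) / N

/-- The chordal function `N sin (π t / N)`. -/
def chord (N : ℕ) (t : ℝ) : ℝ := N * Real.sin (Real.pi * t / N)

/-- `cos (π t / N)`. -/
def cosN (N : ℕ) (t : ℝ) : ℝ := Real.cos (Real.pi * t / N)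

lemma hasDerivAt_dir (N : ℕ) (t : ℝ) : HasDerivAt (dir N) (dir' N t) t := by
  refine HasDerivAt.div_const (HasDerivAt.fun_sum fun k _ => ?_) _
  have := ((hasDerivAt_id t).const_mul (dirFreq N k)).cos
  simpa [mul_comm] using this

lemma hasDerivAt_dir' (N : ℕ) (t : ℝ) : HasDerivAt (dir' N) (dir'' N t) t := by
  refine HasDerivAt.div_const (HasDerivAt.fun_sum fun k _ => ?_) _
  have := (((hasDerivAt_id t).const_mul (dirFreq N k)).sin.const_mul (dirFreq N k)).neg
  refine HasDerivAt.congr_deriv this ?_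
  simp only [id]; ring

lemma hasDerivAt_chord {N : ℕ} (hN : N ≠ 0) (t : ℝ) :
    HasDerivAt (chord N) (Real.pi * cosN N t) t := by
  have h := (((hasDerivAt_id t).const_mul Real.pi).div_const (N : ℝ)).sin.const_mul (N : ℝ)
  have hN' : (N : ℝ) ≠ 0 := by exact_mod_cast hN
  refine HasDerivAt.congr_deriv h ?_
  simp only [cosN, id]
  field_simp

lemma hasDerivAt_cosN {N : ℕ} (hN : N ≠ 0) (t : ℝ) :
    HasDerivAt (cosN N) (-(Real.pi / N ^ 2 * chord N t)) t := by
  have h := (((hasDerivAt_id t).const_mul Real.pi).div_const (N : ℝ)).cos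
  have hN' : (N : ℝ) ≠ 0 := by exact_mod_cast hN
  refine HasDerivAt.congr_deriv h ?_
  simp only [chord, id]
  field_simp

lemma dir_mul_chord {N : ℕ} (hN : N ≠ 0) (t : ℝ) :
    dir N t * chord N t = Real.sin (Real.pi * t) := by
  have hN' : (N : ℝ) ≠ 0 := by exact_mod_cast hN
  have h1 : dir N t * chord N t
      = ∑ k ∈ Finset.range N, Real.cos (dirFreq N k * t) * Real.sin (Real.pi * t / N) := by
    rw [dir, chord, ← Finset.sum_mul, div_mul_eq_mul_div, div_eq_iff hN']; ring
  have h2 : ∀ k : ℕ, Real.cos (dirFreq N k * t) * Real.sin (Real.pi * t / N)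
      = Real.sin (Real.pi * (2 * (k + 1 : ℕ) - N) / N * t) / 2
        - Real.sin (Real.pi * (2 * (k : ℕ) - N) / N * t) / 2 := by
    intro k
    have e1 : Real.pi * (2 * (k + 1 : ℕ) - N) / N * t = dirFreq N k * t + Real.pi * t / N := by
      simp only [dirFreq]; push_cast; field_simp; ring
    have e2 : Real.pi * (2 * (k : ℕ) - N) / N * t = dirFreq N k * t - Real.pi * t / N := by
      simp only [dirFreq]; field_simp; ring
    rw [e1, e2, Real.sin_add, Real.sin_sub]; ring
  rw [h1, Finset.sum_congr rfl fun k _ => h2 k,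
    Finset.sum_range_sub fun k : ℕ => Real.sin (Real.pi * (2 * (k : ℕ) - N) / N * t) / 2]
  have e3 : Real.pi * (2 * (N : ℝ) - N) / N * t = Real.pi * t := by field_simp; ring
  have e4 : Real.pi * (2 * ((0 : ℕ) : ℝ) - N) / N * t = -(Real.pi * t) := by
    push_cast; field_simp; ring
  rw [e3, e4, Real.sin_neg]; ring

lemma dir'_mul_chord {N : ℕ} (hN : N ≠ 0) (t : ℝ) :
    dir' N t * chord N t + dir N t * (Real.pi * cosN N t) = Real.pi * Real.cos (Real.pi * t) := by
  have h1 := (hasDerivAt_dir N t).mul (hasDerivAt_chord hN t)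
  have h2 : dir N * chord N = fun t => Real.sin (Real.pi * t) :=
    funext fun t => dir_mul_chord hN t
  rw [h2] at h1
  have h3 := ((hasDerivAt_id t).const_mul Real.pi).sin
  rw [h1.unique h3]; simp; ring

lemma dir''_mul_chord {N : ℕ} (hN : N ≠ 0) (t : ℝ) :
    dir'' N t * chord N t + 2 * dir' N t * (Real.pi * cosN N t)
      - dir N t * (Real.pi ^ 2 / N ^ 2 * chord N t) = -(Real.pi ^ 2 * Real.sin (Real.pi * t)) := by
  have h1 := ((hasDerivAt_dir' N t).mul (hasDerivAt_chord hN t)).add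
    ((hasDerivAt_dir N t).mul ((hasDerivAt_cosN hN t).const_mul Real.pi))
  have h2 : dir' N * chord N + dir N * (fun y => Real.pi * cosN N y)
      = fun t => Real.pi * Real.cos (Real.pi * t) :=
    funext fun t => dir'_mul_chord hN t
  rw [h2] at h1
  have h3 := ((hasDerivAt_id t).const_mul Real.pi).cos.const_mul Real.pi
  have h4 := h1.unique h3
  simp only [id, mul_one] at h4
  linear_combination h4

lemma abs_dirFreq_le {N k : ℕ} (hk : k < N) : |dirFreq N k| ≤ Real.pi := by
  have hN : (0 : ℝ) < N := by exact_mod_cast (Nat.zero_le k).trans_lt hk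
  have hk' : (k : ℝ) + 1 ≤ N := by exact_mod_cast hk
  have hk0 : (0 : ℝ) ≤ k := k.cast_nonneg
  rw [dirFreq, abs_div, abs_mul, abs_of_pos Real.pi_pos, abs_of_pos hN, div_le_iff₀ hN]
  refine mul_le_mul_of_nonneg_left ?_ Real.pi_pos.le
  rw [abs_le]; constructor <;> linarith

lemma abs_sum_range_div_le {N : ℕ} {f : ℕ → ℝ} {c : ℝ} (hc : 0 ≤ c)
    (h : ∀ k < N, |f k| ≤ c) : |(∑ k ∈ Finset.range N, f k) / N| ≤ c := by
  rw [abs_div, Nat.abs_cast]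
  refine div_le_of_le_mul₀ N.cast_nonneg hc ?_
  refine (Finset.abs_sum_le_sum_abs _ _).trans ?_
  refine (Finset.sum_le_card_nsmul _ _ c fun k hk => h k (Finset.mem_range.1 hk)).trans ?_
  simp [mul_comm]

lemma abs_dir_le (N : ℕ) (t : ℝ) : |dir N t| ≤ 1 :=
  abs_sum_range_div_le zero_le_one fun _ _ => Real.abs_cos_le_one _

lemma abs_dir'_le (N : ℕ) (t : ℝ) : |dir' N t| ≤ Real.pi := by
  refine abs_sum_range_div_le Real.pi_pos.le fun k hk => ?_
  rw [abs_neg, abs_mul]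
  exact (mul_le_of_le_one_right (abs_nonneg _) (Real.abs_sin_le_one _)).trans (abs_dirFreq_le hk)

lemma abs_dir''_le (N : ℕ) (t : ℝ) : |dir'' N t| ≤ Real.pi ^ 2 := by
  refine abs_sum_range_div_le (by positivity) fun k hk => ?_
  rw [abs_neg, abs_mul, abs_pow]
  exact (mul_le_of_le_one_right (by positivity) (Real.abs_cos_le_one _)).trans
    (pow_le_pow_left₀ (abs_nonneg _) (abs_dirFreq_le hk) 2)

lemma dir_zero {N : ℕ} (hN : N ≠ 0) : dir N 0 = 1 := by
  have hN' : (N : ℝ) ≠ 0 := by exact_mod_cast hN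
  simp [dir, hN']

lemma dir'_zero (N : ℕ) : dir' N 0 = 0 := by simp [dir']

lemma dir_neg (N : ℕ) (t : ℝ) : dir N (-t) = dir N t := by
  simp [dir]

lemma dir_nonneg {N : ℕ} {t : ℝ} (ht : |t| ≤ 1 / 2) : 0 ≤ dir N t := by
  refine div_nonneg (Finset.sum_nonneg fun k hk => ?_) N.cast_nonneg
  have h : |dirFreq N k * t| ≤ Real.pi / 2 := by
    rw [abs_mul]
    calc |dirFreq N k| * |t| ≤ Real.pi * (1 / 2) := mul_le_mul
          (abs_dirFreq_le (Finset.mem_range.1 hk)) ht (abs_nonneg _) Real.pi_pos.le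
      _ = _ := by ring
  rw [abs_le] at h
  exact Real.cos_nonneg_of_mem_Icc ⟨by linarith, h.2⟩

lemma dir_antitone {N : ℕ} {s t : ℝ} (hs : 0 ≤ s) (hst : s ≤ t) (ht : t ≤ 1) :
    dir N t ≤ dir N s := by
  refine div_le_div_of_nonneg_right (Finset.sum_le_sum fun k hk => ?_) N.cast_nonneg
  have h0 := abs_dirFreq_le (Finset.mem_range.1 hk)
  rw [← Real.cos_abs (_ * t), ← Real.cos_abs (_ * s), abs_mul, abs_mul, abs_of_nonneg hs,
    abs_of_nonneg (hs.trans hst)]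
  refine Real.cos_le_cos_of_nonneg_of_le_pi (by positivity) ?_
    (mul_le_mul_of_nonneg_left hst (abs_nonneg _))
  calc |dirFreq N k| * t ≤ Real.pi * 1 :=
        mul_le_mul h0 ht (hs.trans hst) Real.pi_pos.le
    _ = _ := mul_one _

/-! ### The interpolation kernels -/

/-- The kernel `D⁴`. -/
def ker (N : ℕ) (t : ℝ) : ℝ := dir N t ^ 4

/-- The derivative of `ker`. -/
def ker' (N : ℕ) (t : ℝ) : ℝ := 4 * dir N t ^ 3 * dir' N t

/-- The second derivative of `ker`. -/
def ker'' (N : ℕ) (t : ℝ) : ℝ :=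
  12 * dir N t ^ 2 * dir' N t ^ 2 + 4 * dir N t ^ 3 * dir'' N t

/-- The odd function `N sin (2 π t / N) / (2 π)`, close to `t` near `0`. -/
def oddN (N : ℕ) (t : ℝ) : ℝ := chord N t * cosN N t / Real.pi

/-- The derivative of `oddN`. -/
def oddN' (N : ℕ) (t : ℝ) : ℝ := Real.cos (2 * (Real.pi * t / N))

/-- The second derivative of `oddN`. -/
def oddN'' (N : ℕ) (t : ℝ) : ℝ := -(4 * Real.pi ^ 2 / N ^ 2) * oddN N t

/-- The kernel used to prescribe derivatives. -/
def oker (N : ℕ) (t : ℝ) : ℝ := oddN N t * ker N t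

/-- The derivative of `oker`. -/
def oker' (N : ℕ) (t : ℝ) : ℝ := oddN' N t * ker N t + oddN N t * ker' N t

/-- The second derivative of `oker`. -/
def oker'' (N : ℕ) (t : ℝ) : ℝ :=
  oddN'' N t * ker N t + 2 * oddN' N t * ker' N t + oddN N t * ker'' N t

lemma hasDerivAt_ker (N : ℕ) (t : ℝ) : HasDerivAt (ker N) (ker' N t) t := by
  refine HasDerivAt.congr_deriv ((hasDerivAt_dir N t).pow 4) ?_
  simp [ker']

lemma hasDerivAt_ker' (N : ℕ) (t : ℝ) : HasDerivAt (ker' N) (ker'' N t) t := by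
  have h := (((hasDerivAt_dir N t).pow 3).const_mul 4).mul (hasDerivAt_dir' N t)
  refine HasDerivAt.congr_deriv h ?_
  simp only [ker'', Pi.pow_apply, Nat.cast_ofNat]; ring

lemma hasDerivAt_oddN {N : ℕ} (hN : N ≠ 0) (t : ℝ) : HasDerivAt (oddN N) (oddN' N t) t := by
  have h := ((hasDerivAt_chord hN t).mul (hasDerivAt_cosN hN t)).div_const Real.pi
  refine HasDerivAt.congr_deriv h ?_
  have hN' : (N : ℝ) ≠ 0 := by exact_mod_cast hN
  have := Real.pi_ne_zero
  simp only [oddN', chord, cosN, Real.cos_two_mul']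
  field_simp
  ring

lemma hasDerivAt_oddN' {N : ℕ} (hN : N ≠ 0) (t : ℝ) : HasDerivAt (oddN' N) (oddN'' N t) t := by
  have h := ((((hasDerivAt_id t).const_mul Real.pi).div_const (N : ℝ)).const_mul 2).cos
  refine HasDerivAt.congr_deriv h ?_
  have hN' : (N : ℝ) ≠ 0 := by exact_mod_cast hN
  have := Real.pi_ne_zero
  simp only [oddN'', oddN, chord, cosN, id, Real.sin_two_mul]
  field_simp
  ring

lemma hasDerivAt_oker {N : ℕ} (hN : N ≠ 0) (t : ℝ) : HasDerivAt (oker N) (oker' N t) t :=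
  (hasDerivAt_oddN hN t).mul (hasDerivAt_ker N t)

lemma hasDerivAt_oker' {N : ℕ} (hN : N ≠ 0) (t : ℝ) : HasDerivAt (oker' N) (oker'' N t) t := by
  have h := ((hasDerivAt_oddN' hN t).mul (hasDerivAt_ker N t)).add
    ((hasDerivAt_oddN hN t).mul (hasDerivAt_ker' N t))
  refine HasDerivAt.congr_deriv h ?_
  simp only [oker'']; ring

lemma ker_zero {N : ℕ} (hN : N ≠ 0) : ker N 0 = 1 := by simp [ker, dir_zero hN]
lemma ker'_zero (N : ℕ) : ker' N 0 = 0 := by simp [ker', dir'_zero]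
lemma oddN_zero (N : ℕ) : oddN N 0 = 0 := by simp [oddN, chord]
lemma oker_zero (N : ℕ) : oker N 0 = 0 := by simp [oker, oddN_zero]
lemma oker'_zero {N : ℕ} (hN : N ≠ 0) : oker' N 0 = 1 := by
  simp [oker', oddN', ker_zero hN, oddN_zero]

lemma ker_nonneg (N : ℕ) (t : ℝ) : 0 ≤ ker N t := by rw [ker]; positivity

lemma ker_le_one (N : ℕ) (t : ℝ) : ker N t ≤ 1 := by
  rw [ker, ← abs_of_nonneg (by positivity : 0 ≤ dir N t ^ 4), abs_pow]
  exact pow_le_one₀ (abs_nonneg _) (abs_dir_le N t)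

lemma abs_ker'_le (N : ℕ) (t : ℝ) : |ker' N t| ≤ 4 * Real.pi := by
  rw [ker', abs_mul, abs_mul, abs_pow, abs_of_pos (by norm_num : (0 : ℝ) < 4)]
  refine mul_le_mul ?_ (abs_dir'_le N t) (abs_nonneg _) (by norm_num)
  have := pow_le_one₀ (n := 3) (abs_nonneg _) (abs_dir_le N t)
  linarith

lemma abs_ker''_le (N : ℕ) (t : ℝ) : |ker'' N t| ≤ 16 * Real.pi ^ 2 := by
  have h0 := abs_dir_le N t
  have h2 : |dir N t| ^ 2 ≤ 1 := pow_le_one₀ (abs_nonneg _) h0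
  have h3 : |dir N t| ^ 3 ≤ 1 := pow_le_one₀ (abs_nonneg _) h0
  have h4 : |dir' N t| ^ 2 ≤ Real.pi ^ 2 := pow_le_pow_left₀ (abs_nonneg _) (abs_dir'_le N t) 2
  rw [ker'']
  refine (abs_add_le _ _).trans ?_
  simp only [abs_mul, abs_pow, abs_of_pos (by norm_num : (0 : ℝ) < 12),
    abs_of_pos (by norm_num : (0 : ℝ) < 4)]
  have e1 := mul_le_mul h2 h4 (by positivity) zero_le_one
  have e2 := mul_le_mul h3 (abs_dir''_le N t) (abs_nonneg _) zero_le_one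
  linarith

lemma abs_cosN_le (N : ℕ) (t : ℝ) : |cosN N t| ≤ 1 := Real.abs_cos_le_one _

lemma abs_oddN_le (N : ℕ) (t : ℝ) : |oddN N t| ≤ |chord N t| / Real.pi := by
  rw [oddN, abs_div, abs_mul, abs_of_pos Real.pi_pos]
  exact div_le_div_of_nonneg_right
    (mul_le_of_le_one_right (abs_nonneg _) (abs_cosN_le N t)) Real.pi_pos.le

lemma abs_oddN'_le (N : ℕ) (t : ℝ) : |oddN' N t| ≤ 1 := Real.abs_cos_le_one _

lemma abs_oddN''_le {N : ℕ} (hN : 64 ≤ N) (t : ℝ) : |oddN'' N t| ≤ 1 / 100 * |oddN N t| := by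
  have hN' : (64 : ℝ) ≤ N := by exact_mod_cast hN
  rw [oddN'', abs_mul, abs_neg, abs_of_nonneg (by positivity)]
  refine mul_le_mul_of_nonneg_right ?_ (abs_nonneg _)
  rw [div_le_iff₀ (by positivity)]
  have := Real.pi_lt_d2
  have := Real.pi_pos
  nlinarith

/-! ### Decay of the kernels -/

lemma abs_sin_cube_mul_cos_le (θ : ℝ) : |Real.sin θ ^ 3 * Real.cos θ| ≤ 1 / 3 := by
  refine abs_le_of_sq_le_sq ?_ (by norm_num)
  have h := Real.sin_sq_add_cos_sq θ
  have e : (Real.sin θ ^ 3 * Real.cos θ) ^ 2 = (Real.sin θ ^ 2) ^ 3 * Real.cos θ ^ 2 := by ring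
  rw [e, show Real.cos θ ^ 2 = 1 - Real.sin θ ^ 2 by linarith]
  set a := Real.sin θ ^ 2
  have ha : 0 ≤ a := sq_nonneg _
  nlinarith [mul_nonneg (sq_nonneg (a - 3 / 4)) (by positivity : 0 ≤ a ^ 2 + a / 2 + 3 / 16)]

lemma dir_eq {N : ℕ} (hN : N ≠ 0) {t : ℝ} (h : chord N t ≠ 0) :
    dir N t = Real.sin (Real.pi * t) * (chord N t)⁻¹ := by
  rw [← dir_mul_chord hN, mul_assoc, mul_inv_cancel₀ h, mul_one]

lemma dir'_eq {N : ℕ} (hN : N ≠ 0) {t : ℝ} (h : chord N t ≠ 0) :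
    dir' N t = Real.pi * (Real.cos (Real.pi * t)
      - cosN N t * Real.sin (Real.pi * t) * (chord N t)⁻¹) * (chord N t)⁻¹ := by
  have e := dir'_mul_chord hN t
  rw [dir_eq hN h] at e
  field_simp
  field_simp at e
  linear_combination e

lemma ker'_eq {N : ℕ} (hN : N ≠ 0) {t : ℝ} (h : chord N t ≠ 0) :
    ker' N t = 4 * Real.pi * (Real.sin (Real.pi * t) ^ 3 * Real.cos (Real.pi * t)
      - cosN N t * Real.sin (Real.pi * t) ^ 4 * (chord N t)⁻¹) * (chord N t)⁻¹ ^ 4 := by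
  rw [ker', dir_eq hN h, dir'_eq hN h]; ring

lemma dir''_eq {N : ℕ} (hN : N ≠ 0) {t : ℝ} (h : chord N t ≠ 0) :
    dir'' N t = -(2 * Real.pi * cosN N t * dir' N t * (chord N t)⁻¹)
      - Real.pi ^ 2 * (1 - 1 / N ^ 2) * dir N t := by
  have e := dir''_mul_chord hN t
  rw [← dir_mul_chord hN] at e
  have h' : dir'' N t = dir'' N t * chord N t * (chord N t)⁻¹ := by
    rw [mul_assoc, mul_inv_cancel₀ h, mul_one]
  rw [h']
  have hi := mul_inv_cancel₀ h
  linear_combination (chord N t)⁻¹ * e +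
    (-Real.pi ^ 2 * (1 - 1 / N ^ 2) * dir N t) * hi

lemma ker''_eq {N : ℕ} (hN : N ≠ 0) {t : ℝ} (h : chord N t ≠ 0) :
    ker'' N t = 4 * Real.pi ^ 2 *
      (Real.sin (Real.pi * t) ^ 2 *
          (3 * Real.cos (Real.pi * t) ^ 2 - (1 - 1 / N ^ 2) * Real.sin (Real.pi * t) ^ 2)
        - 8 * cosN N t * (Real.sin (Real.pi * t) ^ 3 * Real.cos (Real.pi * t)) * (chord N t)⁻¹
        + 5 * cosN N t ^ 2 * Real.sin (Real.pi * t) ^ 4 * (chord N t)⁻¹ ^ 2)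
      * (chord N t)⁻¹ ^ 4 := by
  rw [ker'', dir''_eq hN h, dir'_eq hN h, dir_eq hN h]; ring

lemma ker_le_inv {N : ℕ} (hN : N ≠ 0) {t : ℝ} (h : chord N t ≠ 0) :
    ker N t ≤ |chord N t|⁻¹ ^ 4 := by
  rw [ker, dir_eq hN h, mul_pow, ← abs_inv, Even.pow_abs (by decide)]
  refine mul_le_of_le_one_left (by positivity) ?_
  rw [← Even.pow_abs (by decide)]
  exact pow_le_one₀ (abs_nonneg _) (Real.abs_sin_le_one _)

lemma abs_ker'_le_inv {N : ℕ} (hN : N ≠ 0) {t : ℝ} (h : chord N t ≠ 0) :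
    |ker' N t| ≤ 4 * Real.pi * (1 / 3 + |chord N t|⁻¹) * |chord N t|⁻¹ ^ 4 := by
  rw [ker'_eq hN h, abs_mul, abs_mul, abs_pow, abs_inv, abs_of_pos (by positivity)]
  refine mul_le_mul_of_nonneg_right (mul_le_mul_of_nonneg_left ?_ (by positivity))
    (by positivity)
  refine (abs_sub _ _).trans (add_le_add (abs_sin_cube_mul_cos_le _) ?_)
  rw [abs_mul, abs_mul, abs_inv, abs_pow]
  refine mul_le_of_le_one_left (by positivity) ?_
  exact mul_le_one₀ (abs_cosN_le N t) (by positivity)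
    (pow_le_one₀ (abs_nonneg _) (Real.abs_sin_le_one _))

lemma abs_ker''_le_inv {N : ℕ} (hN : N ≠ 0) {t : ℝ} (h : chord N t ≠ 0) :
    |ker'' N t| ≤ 4 * Real.pi ^ 2 * (1 + 8 / 3 * |chord N t|⁻¹ + 5 * |chord N t|⁻¹ ^ 2)
      * |chord N t|⁻¹ ^ 4 := by
  have hN1 : (1 : ℝ) ≤ N := by exact_mod_cast Nat.one_le_iff_ne_zero.2 hN
  rw [ker''_eq hN h, abs_mul, abs_mul, abs_pow, abs_inv, abs_of_pos (by positivity)]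
  refine mul_le_mul_of_nonneg_right (mul_le_mul_of_nonneg_left ?_ (by positivity))
    (by positivity)
  have hS := Real.abs_sin_le_one (Real.pi * t)
  have hc := abs_cosN_le N t
  refine (abs_add_le _ _).trans (add_le_add ((abs_sub _ _).trans (add_le_add ?_ ?_)) ?_)
  · have hsc := Real.sin_sq_add_cos_sq (Real.pi * t)
    have hθ : 1 / (N : ℝ) ^ 2 ≤ 1 := by
      rw [div_le_one (by positivity)]; exact one_le_pow₀ hN1
    have hθ0 : 0 ≤ 1 / (N : ℝ) ^ 2 := by positivity
    set θ := 1 / (N : ℝ) ^ 2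
    rw [show Real.cos (Real.pi * t) ^ 2 = 1 - Real.sin (Real.pi * t) ^ 2 by linarith]
    have ha : 0 ≤ Real.sin (Real.pi * t) ^ 2 := sq_nonneg _
    have ha1 : Real.sin (Real.pi * t) ^ 2 ≤ 1 := Real.sin_sq_le_one _
    set a := Real.sin (Real.pi * t) ^ 2
    have h1 : 0 ≤ (1 - θ) * (a * a) := by
      have : 0 ≤ 1 - θ := by linarith
      positivity
    have h2 : (1 - θ) * (a * a) ≤ a * a := by nlinarith [mul_nonneg hθ0 (mul_nonneg ha ha)]
    rw [abs_le]; constructor <;> nlinarith [sq_nonneg (a - 1 / 2)]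
  · rw [abs_mul, abs_mul, abs_mul, abs_inv, abs_of_pos (by norm_num : (0 : ℝ) < 8)]
    refine mul_le_mul_of_nonneg_right ?_ (by positivity)
    have := mul_le_mul hc (abs_sin_cube_mul_cos_le (Real.pi * t)) (abs_nonneg _) zero_le_one
    linarith
  · rw [abs_mul, abs_mul, abs_mul, abs_pow, abs_pow, abs_pow, abs_inv,
      abs_of_pos (by norm_num : (0 : ℝ) < 5)]
    refine mul_le_mul_of_nonneg_right ?_ (by positivity)
    have := mul_le_mul (pow_le_one₀ (n := 2) (abs_nonneg _) hc)
      (pow_le_one₀ (n := 4) (abs_nonneg _) hS) (by positivity) zero_le_one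
    linarith

lemma abs_oddN_mul_le {N : ℕ} {t : ℝ} (h : chord N t ≠ 0) {c : ℝ} {u : ℝ}
    (hu : |u| ≤ c * |chord N t|⁻¹ ^ 4) : |oddN N t * u| ≤ c / Real.pi * |chord N t|⁻¹ ^ 3 := by
  rw [abs_mul]
  refine (mul_le_mul (abs_oddN_le N t) hu (abs_nonneg _) (by positivity)).trans_eq ?_
  have : |chord N t| ≠ 0 := abs_ne_zero.2 h
  have := Real.pi_ne_zero
  field_simp

lemma abs_oker_le_inv {N : ℕ} (hN : N ≠ 0) {t : ℝ} (h : chord N t ≠ 0) :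
    |oker N t| ≤ 1 / Real.pi * |chord N t|⁻¹ ^ 3 := by
  refine abs_oddN_mul_le h ?_
  rw [abs_of_nonneg (ker_nonneg N t), one_mul]
  exact ker_le_inv hN h

lemma abs_oker'_le_inv {N : ℕ} (hN : N ≠ 0) {t : ℝ} (h : chord N t ≠ 0) :
    |oker' N t| ≤ |chord N t|⁻¹ ^ 4 + 4 * (1 / 3 + |chord N t|⁻¹) * |chord N t|⁻¹ ^ 3 := by
  refine (abs_add_le _ _).trans (add_le_add ?_ ?_)
  · rw [abs_mul, abs_of_nonneg (ker_nonneg N t)]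
    exact (mul_le_of_le_one_left (ker_nonneg N t) (abs_oddN'_le N t)).trans (ker_le_inv hN h)
  · refine (abs_oddN_mul_le h (abs_ker'_le_inv hN h)).trans_eq ?_
    have := Real.pi_ne_zero
    field_simp

lemma abs_oker''_le_inv {N : ℕ} (hN : 64 ≤ N) {t : ℝ} (h : chord N t ≠ 0) :
    |oker'' N t| ≤ 1 / 100 * (1 / Real.pi * |chord N t|⁻¹ ^ 3)
      + 8 * Real.pi * (1 / 3 + |chord N t|⁻¹) * |chord N t|⁻¹ ^ 4
      + 4 * Real.pi * (1 + 8 / 3 * |chord N t|⁻¹ + 5 * |chord N t|⁻¹ ^ 2)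
        * |chord N t|⁻¹ ^ 3 := by
  have hN0 : N ≠ 0 := by omega
  refine (abs_add_le _ _).trans (add_le_add ((abs_add_le _ _).trans (add_le_add ?_ ?_)) ?_)
  · have h1 := abs_oker_le_inv hN0 h
    rw [oker, abs_mul] at h1
    rw [abs_mul]
    calc _ ≤ (1 / 100 * |oddN N t|) * |ker N t| :=
          mul_le_mul_of_nonneg_right (abs_oddN''_le hN t) (abs_nonneg _)
      _ = 1 / 100 * (|oddN N t| * |ker N t|) := by ring
      _ ≤ _ := by linarith
  · have h1 := abs_ker'_le_inv hN0 h
    rw [abs_mul, abs_mul, abs_of_pos (by norm_num : (0 : ℝ) < 2)]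
    have h2 := mul_le_mul (abs_oddN'_le N t) h1 (abs_nonneg _) zero_le_one
    linarith
  · refine (abs_oddN_mul_le h (abs_ker''_le_inv hN0 h)).trans_eq ?_
    have := Real.pi_ne_zero
    field_simp

/-! ### The kernel near the origin -/

lemma chord_ge_near {N : ℕ} (hN : 64 ≤ N) {s : ℝ} (hs : 0 ≤ s) :
    Real.pi * s * (1 - (Real.pi * s) ^ 2 / 24576) ≤ chord N s := by
  have hN' : (64 : ℝ) ≤ N := by exact_mod_cast hN
  have hN0 : (0 : ℝ) < N := by linarith
  have hp := Real.pi_pos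
  have h := Real.sin_ge_sub_cube (x := Real.pi * s / N) (by positivity)
  have h2 : Real.pi * s - (Real.pi * s) ^ 3 / (6 * N ^ 2) ≤ chord N s := by
    rw [chord]
    calc _ = N * (Real.pi * s / N - (Real.pi * s / N) ^ 3 / 6) := by field_simp
      _ ≤ _ := mul_le_mul_of_nonneg_left h hN0.le
  have h3 : (Real.pi * s) ^ 3 / (6 * N ^ 2) ≤ (Real.pi * s) ^ 3 / 24576 := by
    apply div_le_div_of_nonneg_left (by positivity) (by norm_num)
    nlinarith
  nlinarith

lemma dir_le_near {N : ℕ} (hN : 64 ≤ N) {s : ℝ} (hs : 0 < s) (hs1 : Real.pi * s ≤ 1) :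
    dir N s * (1 - (Real.pi * s) ^ 2 / 24576)
      ≤ 1 - (Real.pi * s) ^ 2 / 6 + (Real.pi * s) ^ 4 / 100 := by
  have hp := Real.pi_pos
  have hd : 0 ≤ dir N s := by
    refine dir_nonneg ?_
    rw [abs_of_pos hs]
    nlinarith [Real.pi_gt_three]
  have h1 := mul_le_mul_of_nonneg_left (chord_ge_near hN hs.le) hd
  rw [dir_mul_chord (by omega)] at h1
  set y := Real.pi * s with hy
  have hy0 : 0 < y := by positivity
  have h2 := (abs_le.1 (Real.sin_bound (x := y) (by rw [abs_of_pos hy0]; exact hs1))).2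
  rw [abs_of_pos hy0] at h2
  refine le_of_mul_le_mul_left ?_ hy0
  nlinarith

lemma ker_eq_ker_abs (N : ℕ) (s : ℝ) : ker N s = ker N |s| := by
  rcases abs_choice s with h | h <;> rw [h]
  rw [ker, ker, dir_neg]

lemma ker_le_near {N : ℕ} (hN : 64 ≤ N) {s : ℝ} (hs : |s| ≤ 1 / 5) :
    ker N s ≤ 1 - 57 / 10 * s ^ 2 := by
  rw [ker_eq_ker_abs, ← sq_abs]
  rcases (abs_nonneg s).eq_or_lt with h0 | h0
  · rw [← h0, ker_zero (by omega)]; norm_num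
  set x := |s|
  have hp1 := Real.pi_gt_d2
  have hp2 := Real.pi_lt_d2
  have hy1 : Real.pi * x ≤ 0.63 := by nlinarith
  have hd := dir_le_near hN h0 (by linarith)
  have hd0 : 0 ≤ dir N x := dir_nonneg (by rw [abs_of_pos h0]; linarith)
  have hy3 : (3.14 * x) ^ 2 ≤ (Real.pi * x) ^ 2 := by gcongr
  set y := Real.pi * x
  have hy0 : 0 < y := by positivity
  have hy2 : y ^ 2 ≤ 0.397 := by nlinarith
  have h1 : dir N x ≤ 1 - 0.1625 * y ^ 2 := by
    set a := y ^ 2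
    have ha : 0 < a := by positivity
    have hd' : dir N x * (1 - a / 24576) ≤ 1 - a / 6 + a ^ 2 / 100 := by
      convert hd using 2; ring
    by_contra hcon
    push Not at hcon
    have : (1 - 0.1625 * a) * (1 - a / 24576) < dir N x * (1 - a / 24576) :=
      mul_lt_mul_of_pos_right hcon (by linarith)
    nlinarith
  have h2 : ker N x ≤ (1 - 0.1625 * y ^ 2) ^ 4 := pow_le_pow_left₀ hd0 h1 4
  refine h2.trans ?_
  have h3 : 0.1625 * (3.14 * x) ^ 2 ≤ 0.1625 * y ^ 2 := by linarith
  have hx2 : x ^ 2 ≤ 1 / 25 := by nlinarith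
  set v := 0.1625 * (3.14 * x) ^ 2 with hv
  have hv0 : 0 ≤ v := by positivity
  have hv1 : v ≤ 0.0641 := by rw [hv]; nlinarith
  have h4 : (1 - 0.1625 * y ^ 2) ^ 4 ≤ (1 - v) ^ 4 := by
    apply pow_le_pow_left₀ (by nlinarith); linarith
  refine h4.trans ?_
  have h5 : (1 - v) ^ 4 ≤ 1 - 3.6154 * v := by
    nlinarith [mul_nonneg hv0 hv0, mul_nonneg (mul_nonneg hv0 hv0) hv0]
  have h6 : 3.6154 * v = 3.6154 * 0.1625 * 9.8596 * x ^ 2 := by rw [hv]; ring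
  nlinarith [sq_nonneg x]

lemma ker_le_of_le {N : ℕ} {s₀ s b : ℝ} (h0 : 0 ≤ s₀) (hb : dir N s₀ ≤ b)
    (hs : s₀ ≤ |s|) (hs1 : |s| ≤ 1 / 2) : ker N s ≤ b ^ 4 := by
  rw [ker_eq_ker_abs]
  refine pow_le_pow_left₀ (dir_nonneg (by rwa [abs_abs])) ?_ 4
  exact (dir_antitone h0 hs (by linarith)).trans hb

lemma ker_le_of_one_fifth_le {N : ℕ} (hN : 64 ≤ N) {s : ℝ} (hs : 1 / 5 ≤ |s|)
    (hs1 : |s| ≤ 1 / 2) : ker N s ≤ 0.773 := by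
  have h := ker_le_near hN (s := 1 / 5) (by rw [abs_of_pos (by norm_num)])
  rw [ker_eq_ker_abs]
  refine le_trans (pow_le_pow_left₀ (dir_nonneg (by rwa [abs_abs]))
    (dir_antitone (by norm_num) hs (by linarith)) 4) ?_
  rw [ker] at h
  linarith

lemma ker_le_of_three_tenths_le {N : ℕ} (hN : 64 ≤ N) {s : ℝ} (hs : 3 / 10 ≤ |s|)
    (hs1 : |s| ≤ 1 / 2) : ker N s ≤ 0.56 := by
  have hp1 := Real.pi_gt_d2
  have hp2 := Real.pi_lt_d2
  have hd := dir_le_near hN (s := 3 / 10) (by norm_num) (by linarith)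
  have hy1 : 0.942 ≤ Real.pi * (3 / 10) := by linarith
  have hy2 : Real.pi * (3 / 10) ≤ 0.945 := by linarith
  have hb : dir N (3 / 10) ≤ 0.864 := by
    set y := Real.pi * (3 / 10)
    have a1 : 0.887 ≤ y ^ 2 := by nlinarith
    have a2 : y ^ 2 ≤ 0.8931 := by nlinarith
    have a3 : y ^ 4 ≤ 0.798 := by nlinarith
    nlinarith
  refine (ker_le_of_le (by norm_num) hb hs hs1).trans ?_
  norm_num

lemma abs_sub_oddN_le {N : ℕ} (hN : 64 ≤ N) (s : ℝ) :
    |s - oddN N s| ≤ 1 / 500 * |s| ^ 3 := by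
  have hN' : (64 : ℝ) ≤ N := by exact_mod_cast hN
  have hp := Real.pi_pos
  wlog hs : 0 ≤ s generalizing s
  · have h := this (-s) (by linarith)
    have e : oddN N (-s) = -oddN N s := by
      simp [oddN, chord, cosN, mul_neg, neg_div]
    rw [e, abs_neg] at h
    rw [abs_sub_comm]
    convert h using 2
    ring
  have e : oddN N s = N / (2 * Real.pi) * Real.sin (2 * (Real.pi * s / N)) := by
    rw [Real.sin_two_mul, oddN, chord, cosN]; field_simp
  have hz : 0 ≤ 2 * (Real.pi * s / N) := by positivity
  have h1 := mul_le_mul_of_nonneg_left (Real.sin_le hz)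
    (by positivity : 0 ≤ N / (2 * Real.pi))
  have h2 := mul_le_mul_of_nonneg_left (Real.sin_ge_sub_cube hz)
    (by positivity : 0 ≤ N / (2 * Real.pi))
  rw [← e] at h1 h2
  have e1 : N / (2 * Real.pi) * (2 * (Real.pi * s / N)) = s := by field_simp
  have e2 : N / (2 * Real.pi) * (2 * (Real.pi * s / N) - (2 * (Real.pi * s / N)) ^ 3 / 6)
      = s - 2 * Real.pi ^ 2 / (3 * N ^ 2) * s ^ 3 := by field_simp; ring
  rw [e1] at h1
  rw [e2] at h2
  have h3 : 2 * Real.pi ^ 2 / (3 * (N : ℝ) ^ 2) ≤ 1 / 500 := by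
    rw [div_le_iff₀ (by positivity)]
    nlinarith [Real.pi_lt_d2]
  rw [abs_of_nonneg (by linarith), abs_of_nonneg hs]
  have := mul_le_mul_of_nonneg_right h3 (by positivity : 0 ≤ s ^ 3)
  linarith

/-! ### Sums over separated points -/

lemma abs_chord_eq {N : ℕ} (hN : 0 < N) {r : ℝ} (hr : |r| ≤ N / 2) :
    |chord N r| = chord N |r| := by
  have hN' : (0 : ℝ) < N := by exact_mod_cast hN
  have hp := Real.pi_pos
  have h0 : 0 ≤ chord N |r| := by
    refine mul_nonneg hN'.le (Real.sin_nonneg_of_nonneg_of_le_pi (by positivity) ?_)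
    rw [div_le_iff₀ hN']
    nlinarith
  rcases abs_choice r with h | h
  · rw [h] at h0 ⊢; exact abs_of_nonneg h0
  · have e : chord N r = -chord N |r| := by
      rw [h]; simp [chord, neg_div]
    rw [e, abs_neg, abs_of_nonneg h0]

lemma chord_mono {N : ℕ} (hN : 0 < N) {x y : ℝ} (hx : 0 ≤ x) (hxy : x ≤ y) (hy : y ≤ N / 2) :
    chord N x ≤ chord N y := by
  have hN' : (0 : ℝ) < N := by exact_mod_cast hN
  have hp := Real.pi_pos
  refine mul_le_mul_of_nonneg_left (Real.sin_le_sin_of_le_of_le_pi_div_two ?_ ?_ ?_) hN'.le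
  · have : 0 ≤ Real.pi * x / N := by positivity
    linarith
  · rw [div_le_iff₀ hN']; nlinarith
  · gcongr

lemma mul_le_abs_chord {N : ℕ} (hN : 64 ≤ N) {x r : ℝ} (hx : 0 ≤ x) (hx5 : x ≤ 5)
    (hxr : x ≤ |r|) (hr : |r| ≤ N / 2) : 3.1 * x ≤ |chord N r| := by
  rw [abs_chord_eq (by omega) hr]
  refine le_trans ?_ (chord_mono (by omega) hx hxr hr)
  refine le_trans ?_ (chord_ge_near hN hx)
  have hp1 := Real.pi_gt_d2
  have hp2 := Real.pi_lt_d2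
  have hy : Real.pi * x ≤ 15.75 := by nlinarith
  have hy0 : 0 ≤ Real.pi * x := by positivity
  have h1 : 1 - (Real.pi * x) ^ 2 / 24576 ≥ 0.9899 := by nlinarith
  calc 3.1 * x ≤ 3.14 * x * 0.9899 := by nlinarith
    _ ≤ Real.pi * x * (1 - (Real.pi * x) ^ 2 / 24576) := by gcongr

lemma two_mul_le_abs_chord {N : ℕ} (hN : 0 < N) {x r : ℝ} (hx : 0 ≤ x)
    (hxr : x ≤ |r|) (hr : |r| ≤ N / 2) : 2 * x ≤ |chord N r| := by
  have hN' : (0 : ℝ) < N := by exact_mod_cast hN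
  have hp := Real.pi_pos
  rw [abs_chord_eq hN hr]
  refine le_trans ?_ (chord_mono hN hx hxr hr)
  have h := Real.mul_le_sin (x := Real.pi * x / N) (by positivity) (by
    rw [div_le_iff₀ hN']; nlinarith)
  have h2 := mul_le_mul_of_nonneg_left h hN'.le
  have e : N * (2 / Real.pi * (Real.pi * x / N)) = 2 * x := by field_simp
  rw [e] at h2
  exact h2

lemma sum_floor_le {ι : Type*} {T : Finset ι} {r : ι → ℝ} {n : ℕ}
    (hsep : ∀ k ∈ T, ∀ l ∈ T, k ≠ l → 1 ≤ |r k - r l|) (h1 : ∀ k ∈ T, 1 ≤ |r k|)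
    (hn : ∀ k ∈ T, |r k| ≤ n) {g : ℕ → ℝ} (hg : ∀ m, 0 ≤ g m) :
    ∑ k ∈ T, g ⌊|r k|⌋₊ ≤ 2 * ∑ m ∈ Finset.Icc 1 n, g m := by
  classical
  let p : ι → ℕ × Bool := fun k => (⌊|r k|⌋₊, decide (0 ≤ r k))
  have hinj : Set.InjOn p T := by
    intro k hk l hl hkl
    by_contra hne
    have hs := hsep k hk l hl hne
    simp only [p, Prod.mk.injEq, decide_eq_decide] at hkl
    obtain ⟨hf, hd⟩ := hkl
    have a1 := Nat.floor_le (abs_nonneg (r k))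
    have a2 := Nat.lt_floor_add_one |r k|
    have a3 := Nat.floor_le (abs_nonneg (r l))
    have a4 := Nat.lt_floor_add_one |r l|
    rw [hf] at a1 a2
    generalize (⌊|r l|⌋₊ : ℝ) = m at a1 a2 a3 a4
    by_cases h0 : 0 ≤ r k
    · have h0' := hd.1 h0
      rw [abs_of_nonneg h0] at a1 a2
      rw [abs_of_nonneg h0'] at a3 a4
      rcases le_abs'.1 hs with h | h <;> linarith
    · have h0' : r l < 0 := not_le.1 fun h => h0 (hd.2 h)
      push Not at h0
      rw [abs_of_neg h0] at a1 a2
      rw [abs_of_neg h0'] at a3 a4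
      rcases le_abs'.1 hs with h | h <;> linarith
  have himg : T.image p ⊆ Finset.Icc 1 n ×ˢ (Finset.univ : Finset Bool) := by
    intro x hx
    obtain ⟨k, hk, rfl⟩ := Finset.mem_image.1 hx
    simp only [p, Finset.mem_product, Finset.mem_Icc, Finset.mem_univ, and_true]
    exact ⟨Nat.le_floor (by simpa using h1 k hk), Nat.floor_le_of_le (hn k hk)⟩
  calc ∑ k ∈ T, g ⌊|r k|⌋₊ = ∑ x ∈ T.image p, g x.1 := by
        rw [Finset.sum_image hinj]
    _ ≤ ∑ x ∈ Finset.Icc 1 n ×ˢ (Finset.univ : Finset Bool), g x.1 :=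
      Finset.sum_le_sum_of_subset_of_nonneg himg fun x _ _ => hg _
    _ = _ := by rw [Finset.sum_product, Finset.mul_sum]; simp

/-- Lower bound for the chordal distance of points in the bin `[m, m + 1)`. -/
def binChord (m : ℕ) : ℝ := if m ≤ 5 then 3.1 * m else 2 * m

lemma sum_binChord_three {n : ℕ} (hn : 5 ≤ n) :
    ∑ m ∈ Finset.Icc 1 n, (binChord m)⁻¹ ^ 3 ≤ 0.042 - 1 / (16 * n * (n + 1)) := by
  induction n, hn using Nat.le_induction with
  | base => norm_num [Finset.sum_Icc_succ_top, binChord]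
  | succ n hn ih =>
    rw [Finset.sum_Icc_succ_top (by omega)]
    have h : (binChord (n + 1))⁻¹ ^ 3
        ≤ 1 / (16 * n * (n + 1)) - 1 / (16 * ((n + 1 : ℕ) : ℝ) * ((n + 1 : ℕ) + 1)) := by
      have hn' : (5 : ℝ) ≤ n := by exact_mod_cast hn
      rw [binChord, if_neg (by omega)]
      push_cast
      rw [div_sub_div _ _ (by positivity) (by positivity), inv_pow, ← one_div,
        div_le_div_iff₀ (by positivity) (by positivity), ← sub_nonneg]
      have e : (1 * (16 * ((n : ℝ) + 1) * (n + 1 + 1)) - 16 * n * (n + 1) * 1) * (2 * (n + 1)) ^ 3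
          - 1 * (16 * n * (n + 1) * (16 * (n + 1) * (n + 1 + 1)))
          = 256 * (n + 1) ^ 2 := by ring
      rw [e]
      positivity
    linarith

lemma sum_binChord_four {n : ℕ} (hn : 5 ≤ n) :
    ∑ m ∈ Finset.Icc 1 n, (binChord m)⁻¹ ^ 4 ≤ 0.012 - 1 / (192 * n * (n + 1)) := by
  induction n, hn using Nat.le_induction with
  | base => norm_num [Finset.sum_Icc_succ_top, binChord]
  | succ n hn ih =>
    rw [Finset.sum_Icc_succ_top (by omega)]
    have h : (binChord (n + 1))⁻¹ ^ 4
        ≤ 1 / (192 * n * (n + 1)) - 1 / (192 * ((n + 1 : ℕ) : ℝ) * ((n + 1 : ℕ) + 1)) := by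
      have hn' : (5 : ℝ) ≤ n := by exact_mod_cast hn
      rw [binChord, if_neg (by omega)]
      push_cast
      rw [div_sub_div _ _ (by positivity) (by positivity), inv_pow, ← one_div,
        div_le_div_iff₀ (by positivity) (by positivity), ← sub_nonneg]
      have e : (1 * (192 * ((n : ℝ) + 1) * (n + 1 + 1)) - 192 * n * (n + 1) * 1)
            * (2 * (n + 1)) ^ 4
          - 1 * (192 * n * (n + 1) * (192 * (n + 1) * (n + 1 + 1)))
          = 6144 * (n + 1) ^ 2 * ((n - 5) * (n + 1) ^ 2 + 6) := by ring
      rw [e]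
      have : (0 : ℝ) ≤ n - 5 := by linarith
      positivity
    linarith

section Packing

variable {ι : Type*} {N : ℕ} {T : Finset ι} {r : ι → ℝ}

lemma binChord_pos {m : ℕ} (hm : 1 ≤ m) : 0 < binChord m := by
  have : (0 : ℝ) < m := by exact_mod_cast hm
  rw [binChord]; split_ifs <;> positivity

lemma binChord_le (hN : 64 ≤ N) {x : ℝ} (hx : |x| ≤ N / 2) :
    binChord ⌊|x|⌋₊ ≤ |chord N x| := by
  have h := Nat.floor_le (abs_nonneg x)
  rw [binChord]
  split_ifs with h5
  · exact mul_le_abs_chord hN (Nat.cast_nonneg _) (by exact_mod_cast h5) h hx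
  · exact two_mul_le_abs_chord (by omega) (Nat.cast_nonneg _) h hx

lemma sum_inv_chord_le_of_one_le (hN : 64 ≤ N) (hr : ∀ k ∈ T, |r k| ≤ N / 2)
    (hsep : ∀ k ∈ T, ∀ l ∈ T, k ≠ l → 1 ≤ |r k - r l|) (h1 : ∀ k ∈ T, 1 ≤ |r k|) (p : ℕ) :
    ∑ k ∈ T, |chord N (r k)|⁻¹ ^ p ≤ 2 * ∑ m ∈ Finset.Icc 1 N, (binChord m)⁻¹ ^ p := by
  have hb : ∀ m, 0 ≤ (binChord m)⁻¹ ^ p := by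
    intro m
    have : 0 ≤ binChord m := by rw [binChord]; split_ifs <;> positivity
    positivity
  refine le_trans (Finset.sum_le_sum fun k hk => ?_) (sum_floor_le hsep h1 (fun k hk => ?_) hb)
  · have := binChord_pos (Nat.le_floor (by simpa using h1 k hk) : 1 ≤ ⌊|r k|⌋₊)
    gcongr
    exact binChord_le hN (hr k hk)
  · have := hr k hk
    have : (0 : ℝ) ≤ N := N.cast_nonneg
    linarith

lemma sum_inv_chord_le (hN : 64 ≤ N) (hr : ∀ k ∈ T, |r k| ≤ N / 2)
    (hsep : ∀ k ∈ T, ∀ l ∈ T, k ≠ l → 1 ≤ |r k - r l|) {x : ℝ} (hx0 : 0 < x) (hx1 : x ≤ 1)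
    (hx : ∀ k ∈ T, x ≤ |r k|) {n : ℕ} (hn : (T.filter fun k => |r k| < 1).card ≤ n) :
    ∑ k ∈ T, |chord N (r k)|⁻¹ ^ 3 ≤ n * (3.1 * x)⁻¹ ^ 3 + 0.084 ∧
    ∑ k ∈ T, |chord N (r k)|⁻¹ ^ 4 ≤ n * (3.1 * x)⁻¹ ^ 4 + 0.024 := by
  have hN' : (64 : ℝ) ≤ N := by exact_mod_cast hN
  have key : ∀ p : ℕ, ∑ k ∈ T, |chord N (r k)|⁻¹ ^ p
      ≤ n * (3.1 * x)⁻¹ ^ p + 2 * ∑ m ∈ Finset.Icc 1 N, (binChord m)⁻¹ ^ p := by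
    intro p
    rw [← Finset.sum_filter_add_sum_filter_not T fun k => |r k| < 1]
    refine add_le_add ?_ ?_
    · refine (Finset.sum_le_card_nsmul _ _ ((3.1 * x)⁻¹ ^ p) fun k hk => ?_).trans ?_
      · have hkT := (Finset.mem_filter.1 hk).1
        have := mul_le_abs_chord hN hx0.le (by linarith) (hx k hkT) (hr k hkT)
        gcongr
      · rw [nsmul_eq_mul]
        gcongr
    · refine sum_inv_chord_le_of_one_le hN (fun k hk => hr k (Finset.mem_filter.1 hk).1)
        (fun k hk l hl => hsep k (Finset.mem_filter.1 hk).1 l (Finset.mem_filter.1 hl).1)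
        (fun k hk => ?_) p
      simpa using (Finset.mem_filter.1 hk).2
  have pos : ∀ c : ℝ, 0 < c → 0 ≤ 1 / (c * N * (N + 1)) := fun c hc => by positivity
  constructor
  · have := key 3
    have := sum_binChord_three (n := N) (by omega)
    have := pos 16 (by norm_num)
    linarith
  · have := key 4
    have := sum_binChord_four (n := N) (by omega)
    have := pos 192 (by norm_num)
    linarith

lemma card_abs_lt_one_le_two
    (hsep : ∀ k ∈ T, ∀ l ∈ T, k ≠ l → 1 ≤ |r k - r l|) :
    (T.filter fun k => |r k| < 1).card ≤ 2 := by
  refine (Finset.card_le_card_of_injOn (t := (Finset.univ : Finset Bool))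
    (fun k => decide (0 ≤ r k)) (fun _ _ => Finset.mem_univ _) ?_).trans (by simp)
  intro k hk l hl hkl
  simp only [Finset.coe_filter, Set.mem_ofPred_eq] at hk hl
  by_contra hne
  have hs := hsep k hk.1 l hl.1 hne
  have h1 := abs_lt.1 hk.2
  have h2 := abs_lt.1 hl.2
  simp only [decide_eq_decide] at hkl
  by_cases h0 : 0 ≤ r k
  · have h0' := hkl.1 h0
    rcases le_abs'.1 hs with h | h <;> linarith
  · have h0' : r l < 0 := not_le.1 fun h => h0 (hkl.2 h)
    push Not at h0
    rcases le_abs'.1 hs with h | h <;> linarith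

lemma card_abs_lt_one_le_one
    (hsep : ∀ k ∈ T, ∀ l ∈ T, k ≠ l → 1 ≤ |r k - r l|) {x : ℝ} (hx : |x| ≤ 1 / 2)
    (hxT : ∀ k ∈ T, 1 ≤ |r k - x|) : (T.filter fun k => |r k| < 1).card ≤ 1 := by
  rw [Finset.card_le_one]
  intro k hk l hl
  rw [Finset.mem_filter] at hk hl
  by_contra hne
  have hs := hsep k hk.1 l hl.1 hne
  have h1 := abs_lt.1 hk.2
  have h2 := abs_lt.1 hl.2
  have hx' := abs_le.1 hx
  rcases le_abs'.1 hs with h | h <;> rcases le_abs'.1 (hxT k hk.1) with h' | h' <;>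
    rcases le_abs'.1 (hxT l hl.1) with h'' | h'' <;> linarith

end Packing

/-! ### Reduction modulo `N` -/

/-- The representative of `x` modulo `N` in `[-N/2, N/2]`. -/
def red (N : ℕ) (x : ℝ) : ℝ := x - round (x / N) * N

lemma abs_red_le {N : ℕ} (hN : 0 < N) (x : ℝ) : |red N x| ≤ N / 2 := by
  have hN' : (0 : ℝ) < N := by exact_mod_cast hN
  have h := abs_sub_round (x / N)
  have e : red N x = (x / N - round (x / N)) * N := by rw [red]; field_simp
  rw [e, abs_mul, abs_of_pos hN']
  nlinarith

lemma red_of_abs_le {N : ℕ} (hN : 2 ≤ N) {x : ℝ} (hx : |x| ≤ 1 / 2) : red N x = x := by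
  have hN' : (2 : ℝ) ≤ N := by exact_mod_cast hN
  have hx' := abs_le.1 hx
  have : round (x / N) = 0 := by
    rw [round_eq_zero_iff]
    constructor
    · rw [le_div_iff₀ (by linarith)]; linarith
    · rw [div_lt_iff₀ (by linarith)]; linarith
  rw [red, this]; simp

lemma abs_chord_periodic {N : ℕ} (hN : N ≠ 0) :
    Function.Periodic (fun t => |chord N t|) (N : ℝ) := by
  intro t
  have hN' : (N : ℝ) ≠ 0 := by exact_mod_cast hN
  have e : Real.pi * (t + N) / N = Real.pi * t / N + Real.pi := by field_simp
  simp only [chord]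
  rw [e, Real.sin_add_pi, mul_neg, abs_neg]

lemma ker_periodic {N : ℕ} (hN : N ≠ 0) : Function.Periodic (ker N) (N : ℝ) := by
  intro t
  have hN' : (N : ℝ) ≠ 0 := by exact_mod_cast hN
  have e : dir N (t + N) = (-1) ^ (N + 1) * dir N t := by
    rw [dir, dir, mul_div_assoc', Finset.mul_sum]
    congr 1
    refine Finset.sum_congr rfl fun k _ => ?_
    have e1 : dirFreq N k * (t + N) = dirFreq N k * t + (k : ℤ) * (2 * Real.pi)
        + ((1 - N : ℤ) : ℝ) * Real.pi := by
      rw [dirFreq]; push_cast; field_simp; ring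
    rw [e1, Real.cos_add_int_mul_pi, Real.cos_add_int_mul_two_pi]
    congr 1
    have : ((1 : ℤ) - N) = (N + 1 : ℕ) - 2 * (N : ℤ) := by push_cast; ring
    rw [this, zpow_sub₀ (by norm_num), zpow_natCast, zpow_mul]
    norm_num
  rw [ker, ker, e, mul_pow, ← pow_mul, mul_comm (N + 1) 4, pow_mul]
  norm_num

lemma abs_chord_red {N : ℕ} (hN : N ≠ 0) (x : ℝ) : |chord N (red N x)| = |chord N x| :=
  (abs_chord_periodic hN).sub_int_mul_eq _

lemma ker_red {N : ℕ} (hN : N ≠ 0) (x : ℝ) : ker N (red N x) = ker N x :=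
  (ker_periodic hN).sub_int_mul_eq _

/-- The points `τ i` are `1`-separated modulo `N`. -/
def SepMod {ι : Type*} (N : ℕ) (τ : ι → ℝ) : Prop :=
  ∀ i j, i ≠ j → ∀ n : ℤ, 1 ≤ |τ i - τ j - n * N|

lemma SepMod.red_sub_red {ι : Type*} {N : ℕ} {τ : ι → ℝ} (h : SepMod N τ) (t : ℝ) {i j : ι}
    (hij : i ≠ j) : 1 ≤ |red N (t - τ i) - red N (t - τ j)| := by
  have := h j i hij.symm (round ((t - τ i) / N) - round ((t - τ j) / N))
  convert this using 2
  rw [red, red]; push_cast; ring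

/-! ### Interpolating sums -/

section Interp

variable {ι : Type*} {N : ℕ} {τ : ι → ℝ}

/-- The function `∑ α k ker (t - τ k) + β k oker (t - τ k)`. -/
def interp (N : ℕ) (τ : ι → ℝ) (α β : ι → ℂ) (T : Finset ι) (t : ℝ) : ℂ :=
  ∑ k ∈ T, (α k * ker N (t - τ k) + β k * oker N (t - τ k))

/-- The derivative of `interp`. -/
def interp' (N : ℕ) (τ : ι → ℝ) (α β : ι → ℂ) (T : Finset ι) (t : ℝ) : ℂ :=
  ∑ k ∈ T, (α k * ker' N (t - τ k) + β k * oker' N (t - τ k))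

/-- The second derivative of `interp`. -/
def interp'' (N : ℕ) (τ : ι → ℝ) (α β : ι → ℂ) (T : Finset ι) (t : ℝ) : ℂ :=
  ∑ k ∈ T, (α k * ker'' N (t - τ k) + β k * oker'' N (t - τ k))

lemma hasDerivAt_interp (hN : N ≠ 0) (α β : ι → ℂ) (T : Finset ι) (t : ℝ) :
    HasDerivAt (interp N τ α β T) (interp' N τ α β T t) t :=
  HasDerivAt.fun_sum fun k _ =>
    ((((hasDerivAt_ker N _).comp_sub_const t (τ k)).ofReal_comp).const_mul (α k)).add
    ((((hasDerivAt_oker hN _).comp_sub_const t (τ k)).ofReal_comp).const_mul (β k))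

lemma hasDerivAt_interp' (hN : N ≠ 0) (α β : ι → ℂ) (T : Finset ι) (t : ℝ) :
    HasDerivAt (interp' N τ α β T) (interp'' N τ α β T t) t :=
  HasDerivAt.fun_sum fun k _ =>
    ((((hasDerivAt_ker' N _).comp_sub_const t (τ k)).ofReal_comp).const_mul (α k)).add
    ((((hasDerivAt_oker' hN _).comp_sub_const t (τ k)).ofReal_comp).const_mul (β k))

lemma norm_sum_mul_add_mul_le {T : Finset ι} {α β : ι → ℂ} {u v x : ι → ℝ}
    {A B c₁ c₂ c₃ P₃ P₄ : ℝ} (hA : 0 ≤ A) (hB : 0 ≤ B) (hc₁ : 0 ≤ c₁) (hc₂ : 0 ≤ c₂)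
    (hc₃ : 0 ≤ c₃) (hα : ∀ k ∈ T, ‖α k‖ ≤ A) (hβ : ∀ k ∈ T, ‖β k‖ ≤ B)
    (hu : ∀ k ∈ T, |u k| ≤ c₁ * x k ^ 4)
    (hv : ∀ k ∈ T, |v k| ≤ c₂ * x k ^ 3 + c₃ * x k ^ 4)
    (hP₃ : ∑ k ∈ T, x k ^ 3 ≤ P₃) (hP₄ : ∑ k ∈ T, x k ^ 4 ≤ P₄) :
    ‖∑ k ∈ T, (α k * u k + β k * v k)‖ ≤ A * (c₁ * P₄) + B * (c₂ * P₃ + c₃ * P₄) := by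
  calc ‖∑ k ∈ T, (α k * u k + β k * v k)‖
      ≤ ∑ k ∈ T, (A * (c₁ * x k ^ 4) + B * (c₂ * x k ^ 3 + c₃ * x k ^ 4)) := by
        refine norm_sum_le_of_le _ fun k hk => (norm_add_le _ _).trans ?_
        rw [norm_mul, norm_mul, Complex.norm_real, Complex.norm_real]
        exact add_le_add (mul_le_mul (hα k hk) (hu k hk) (norm_nonneg _) hA)
          (mul_le_mul (hβ k hk) (hv k hk) (norm_nonneg _) hB)
    _ = A * (c₁ * ∑ k ∈ T, x k ^ 4)
        + B * (c₂ * ∑ k ∈ T, x k ^ 3 + c₃ * ∑ k ∈ T, x k ^ 4) := by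
        rw [Finset.sum_add_distrib, ← Finset.mul_sum, ← Finset.mul_sum, ← Finset.mul_sum,
          Finset.sum_add_distrib, ← Finset.mul_sum, ← Finset.mul_sum]
    _ ≤ _ := by gcongr

/-- Bounds for interpolating sums over nodes at positive distance. -/
lemma norm_interp_le_of_sum (hN : 64 ≤ N) {α β : ι → ℂ} {T : Finset ι} {t A B X P₃ P₄ : ℝ}
    (hA : 0 ≤ A) (hB : 0 ≤ B) (hα : ∀ k ∈ T, ‖α k‖ ≤ A) (hβ : ∀ k ∈ T, ‖β k‖ ≤ B)
    (hX : ∀ k ∈ T, chord N (t - τ k) ≠ 0 ∧ |chord N (t - τ k)|⁻¹ ≤ X) (hX0 : 0 ≤ X)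
    (hP₃ : ∑ k ∈ T, |chord N (t - τ k)|⁻¹ ^ 3 ≤ P₃)
    (hP₄ : ∑ k ∈ T, |chord N (t - τ k)|⁻¹ ^ 4 ≤ P₄) :
    ‖interp N τ α β T t‖ ≤ A * P₄ + B * (1 / Real.pi * P₃) ∧
    ‖interp' N τ α β T t‖ ≤ A * (4 * Real.pi * (1 / 3 + X) * P₄)
      + B * (4 * (1 / 3 + X) * P₃ + P₄) ∧
    ‖interp'' N τ α β T t‖ ≤ A * (4 * Real.pi ^ 2 * (1 + 8 / 3 * X + 5 * X ^ 2) * P₄)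
      + B * ((1 / 100 * (1 / Real.pi) + 4 * Real.pi * (1 + 8 / 3 * X + 5 * X ^ 2)) * P₃
        + 8 * Real.pi * (1 / 3 + X) * P₄) := by
  have hN0 : N ≠ 0 := by omega
  have hp := Real.pi_pos
  refine ⟨?_, ?_, ?_⟩
  · have := norm_sum_mul_add_mul_le (c₁ := 1) (c₂ := 1 / Real.pi) (c₃ := 0) hA hB zero_le_one
      (by positivity) le_rfl hα hβ (u := fun k => ker N (t - τ k))
      (v := fun k => oker N (t - τ k)) (fun k hk => ?_) (fun k hk => ?_) hP₃ hP₄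
    · simpa [interp] using this
    · rw [one_mul, abs_of_nonneg (ker_nonneg _ _)]
      exact ker_le_inv hN0 (hX k hk).1
    · rw [zero_mul, add_zero]
      exact abs_oker_le_inv hN0 (hX k hk).1
  · have := norm_sum_mul_add_mul_le (c₁ := 4 * Real.pi * (1 / 3 + X)) (c₂ := 4 * (1 / 3 + X))
      (c₃ := 1) hA hB (by positivity) (by positivity) zero_le_one hα hβ
      (u := fun k => ker' N (t - τ k))
      (v := fun k => oker' N (t - τ k)) (fun k hk => ?_) (fun k hk => ?_) hP₃ hP₄
    · simpa [interp'] using this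
    · refine (abs_ker'_le_inv hN0 (hX k hk).1).trans ?_
      have := (hX k hk).2
      gcongr
    · refine (abs_oker'_le_inv hN0 (hX k hk).1).trans ?_
      have := (hX k hk).2
      rw [one_mul, add_comm]
      gcongr
  · refine norm_sum_mul_add_mul_le hA hB (by positivity) (by positivity) (by positivity) hα hβ
      (u := fun k => ker'' N (t - τ k))
      (v := fun k => oker'' N (t - τ k)) (fun k hk => ?_) (fun k hk => ?_) hP₃ hP₄
    · refine (abs_ker''_le_inv hN0 (hX k hk).1).trans ?_
      have := (hX k hk).2
      gcongr
    · refine (abs_oker''_le_inv hN (hX k hk).1).trans ?_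
      have := (hX k hk).2
      rw [add_right_comm, add_mul, mul_assoc (1 / 100 : ℝ)]
      gcongr

lemma norm_interp_le_of_le (hN : 64 ≤ N) (hτ : SepMod N τ) {α β : ι → ℂ} {T : Finset ι}
    {t A B x : ℝ} (hA : 0 ≤ A) (hB : 0 ≤ B) (hα : ∀ k ∈ T, ‖α k‖ ≤ A)
    (hβ : ∀ k ∈ T, ‖β k‖ ≤ B) (hx0 : 0 < x) (hx1 : x ≤ 1)
    (hx : ∀ k ∈ T, x ≤ |red N (t - τ k)|) {n : ℕ}
    (hn : (T.filter fun k => |red N (t - τ k)| < 1).card ≤ n) {X P₃ P₄ : ℝ}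
    (hX : (3.1 * x)⁻¹ ≤ X) (hP₃ : n * (3.1 * x)⁻¹ ^ 3 + 0.084 ≤ P₃)
    (hP₄ : n * (3.1 * x)⁻¹ ^ 4 + 0.024 ≤ P₄) :
    ‖interp N τ α β T t‖ ≤ A * P₄ + B * (1 / Real.pi * P₃) ∧
    ‖interp' N τ α β T t‖ ≤ A * (4 * Real.pi * (1 / 3 + X) * P₄)
      + B * (4 * (1 / 3 + X) * P₃ + P₄) ∧
    ‖interp'' N τ α β T t‖ ≤ A * (4 * Real.pi ^ 2 * (1 + 8 / 3 * X + 5 * X ^ 2) * P₄)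
      + B * ((1 / 100 * (1 / Real.pi) + 4 * Real.pi * (1 + 8 / 3 * X + 5 * X ^ 2)) * P₃
        + 8 * Real.pi * (1 / 3 + X) * P₄) := by
  have hN0 : N ≠ 0 := by omega
  have hr : ∀ k ∈ T, |red N (t - τ k)| ≤ N / 2 := fun k _ => abs_red_le (by omega) _
  obtain ⟨s₃, s₄⟩ := sum_inv_chord_le (r := fun k => red N (t - τ k)) hN hr
    (fun k _ l _ hkl => hτ.red_sub_red t hkl) hx0 hx1 hx hn
  simp only [abs_chord_red hN0] at s₃ s₄
  refine norm_interp_le_of_sum hN hA hB hα hβ (fun k hk => ?_) (le_trans (by positivity) hX)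
    (s₃.trans hP₃) (s₄.trans hP₄)
  have h := mul_le_abs_chord hN hx0.le (by linarith) (hx k hk) (hr k hk)
  rw [abs_chord_red hN0] at h
  have hpos : 0 < |chord N (t - τ k)| := lt_of_lt_of_le (by positivity) h
  refine ⟨abs_pos.1 hpos, le_trans ?_ hX⟩
  gcongr

lemma red_zero (N : ℕ) : red N 0 = 0 := by simp [red]

variable [Fintype ι] [DecidableEq ι]

lemma interp_univ_eq (α β : ι → ℂ) (j : ι) (t : ℝ) :
    interp N τ α β Finset.univ t = α j * ker N (t - τ j) + β j * oker N (t - τ j)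
      + interp N τ α β (Finset.univ.erase j) t :=
  (Finset.add_sum_erase _ _ (Finset.mem_univ j)).symm

lemma interp'_univ_eq (α β : ι → ℂ) (j : ι) (t : ℝ) :
    interp' N τ α β Finset.univ t = α j * ker' N (t - τ j) + β j * oker' N (t - τ j)
      + interp' N τ α β (Finset.univ.erase j) t :=
  (Finset.add_sum_erase _ _ (Finset.mem_univ j)).symm

lemma interp_node (hN : N ≠ 0) (α β : ι → ℂ) (j : ι) :
    interp N τ α β Finset.univ (τ j)
      = α j + interp N τ α β (Finset.univ.erase j) (τ j) := by
  rw [interp_univ_eq α β j]; simp [ker_zero hN, oker_zero]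

lemma interp'_node (hN : N ≠ 0) (α β : ι → ℂ) (j : ι) :
    interp' N τ α β Finset.univ (τ j)
      = β j + interp' N τ α β (Finset.univ.erase j) (τ j) := by
  rw [interp'_univ_eq α β j]; simp [ker'_zero, oker'_zero hN]

lemma norm_interp_erase_node_le (hN : 64 ≤ N) (hτ : SepMod N τ) (α β : ι → ℂ) (j : ι) :
    ‖interp N τ α β (Finset.univ.erase j) (τ j)‖ ≤ 0.024 * ‖α‖ + 0.0268 * ‖β‖ ∧
    ‖interp' N τ α β (Finset.univ.erase j) (τ j)‖ ≤ 0.1984 * ‖α‖ + 0.2445 * ‖β‖ := by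
  have h1 : ∀ k ∈ Finset.univ.erase j, (1 : ℝ) ≤ |red N (τ j - τ k)| := by
    intro k hk
    have := hτ.red_sub_red (τ j) (Finset.ne_of_mem_erase hk)
    rwa [sub_self, red_zero, sub_zero] at this
  have hcard : ((Finset.univ.erase j).filter fun k => |red N (τ j - τ k)| < 1).card ≤ 0 := by
    rw [Nat.le_zero, Finset.card_eq_zero, Finset.filter_eq_empty_iff]
    exact fun k hk => not_lt.2 (h1 k hk)
  obtain ⟨e1, e2, -⟩ := norm_interp_le_of_le hN hτ (norm_nonneg α) (norm_nonneg β)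
    (fun k _ => norm_le_pi_norm α k) (fun k _ => norm_le_pi_norm β k) one_pos le_rfl h1 hcard
    (X := 0.3226) (P₃ := 0.084) (P₄ := 0.024) (by norm_num) (by norm_num) (by norm_num)
  have hp1 := Real.pi_gt_d2
  have hp2 := Real.pi_lt_d2
  have hpi : 1 / Real.pi ≤ 0.3185 := by
    rw [div_le_iff₀ Real.pi_pos]; linarith
  have a0 := norm_nonneg α
  have b0 := norm_nonneg β
  constructor
  · nlinarith
  · nlinarith

lemma norm_coeff_sub_le (hN : 64 ≤ N) (hτ : SepMod N τ) {α β v w : ι → ℂ}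
    (hv : ∀ j, interp N τ α β Finset.univ (τ j) = v j)
    (hw : ∀ j, interp' N τ α β Finset.univ (τ j) = w j) :
    (∀ j, ‖v j - α j‖ ≤ 0.024 * ‖α‖ + 0.0268 * ‖β‖) ∧
    ‖α‖ ≤ ‖v‖ + (0.024 * ‖α‖ + 0.0268 * ‖β‖) ∧
    ‖β‖ ≤ ‖w‖ + (0.1984 * ‖α‖ + 0.2445 * ‖β‖) := by
  have hN0 : N ≠ 0 := by omega
  have h1 : ∀ j, ‖v j - α j‖ ≤ 0.024 * ‖α‖ + 0.0268 * ‖β‖ := by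
    intro j
    rw [← hv j, interp_node hN0, add_sub_cancel_left]
    exact (norm_interp_erase_node_le hN hτ α β j).1
  refine ⟨h1, ?_, ?_⟩
  · refine (pi_norm_le_iff_of_nonneg (by positivity)).2 fun j => ?_
    have := norm_sub_norm_le (α j) (v j)
    rw [norm_sub_rev] at this
    linarith [h1 j, norm_le_pi_norm v j]
  · refine (pi_norm_le_iff_of_nonneg (by positivity)).2 fun j => ?_
    have h2 := (norm_interp_erase_node_le hN hτ α β j).2
    have h3 : β j = w j - interp' N τ α β (Finset.univ.erase j) (τ j) := by
      rw [← hw j, interp'_node hN0, add_sub_cancel_right]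
    rw [h3]
    exact (norm_sub_le _ _).trans (add_le_add (norm_le_pi_norm w j) h2)

/-- Hermite interpolation at separated nodes. -/
theorem exists_interp (hN : 64 ≤ N) (hτ : SepMod N τ) (v w : ι → ℂ) :
    ∃ α β : ι → ℂ, (∀ j, interp N τ α β Finset.univ (τ j) = v j) ∧
      ∀ j, interp' N τ α β Finset.univ (τ j) = w j := by
  let Φ : ((ι → ℂ) × (ι → ℂ)) →ₗ[ℂ] ((ι → ℂ) × (ι → ℂ)) :=
    { toFun := fun p => (fun j => interp N τ p.1 p.2 Finset.univ (τ j),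
        fun j => interp' N τ p.1 p.2 Finset.univ (τ j))
      map_add' := by
        intro p q
        ext j <;>
        · simp only [interp, interp', Prod.fst_add, Prod.snd_add, Pi.add_apply,
            ← Finset.sum_add_distrib]
          exact Finset.sum_congr rfl fun k _ => by ring
      map_smul' := by
        intro c p
        ext j <;>
        · simp only [interp, interp', Prod.smul_fst, Prod.smul_snd, Pi.smul_apply, smul_eq_mul,
            Finset.mul_sum, RingHom.id_apply]
          exact Finset.sum_congr rfl fun k _ => by ring }
  have hinj : Function.Injective Φ := by
    rw [← LinearMap.ker_eq_bot, LinearMap.ker_eq_bot']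
    rintro ⟨α, β⟩ h
    obtain ⟨-, h1, h2⟩ := norm_coeff_sub_le (v := 0) (w := 0) hN hτ
      (fun j => congrFun (congrArg Prod.fst h) j) (fun j => congrFun (congrArg Prod.snd h) j)
    have a0 := norm_nonneg α
    have b0 := norm_nonneg β
    rw [norm_zero] at h1 h2
    have ha : ‖α‖ = 0 := by linarith
    have hb : ‖β‖ = 0 := by linarith
    rw [norm_eq_zero] at ha hb
    rw [ha, hb]; rfl
  obtain ⟨⟨α, β⟩, h⟩ := (LinearMap.injective_iff_surjective.1 hinj) (v, w)
  exact ⟨α, β, fun j => congrFun (congrArg Prod.fst h) j,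
    fun j => congrFun (congrArg Prod.snd h) j⟩

end Interp

/-! ### A second order Taylor estimate -/

lemma norm_taylor_le_of_nonneg {f f' : ℝ → ℂ} {E a : ℝ} (hf : ∀ t, HasDerivAt f (f' t) t)
    (hf' : ∀ t, |t| ≤ a → ‖f' t - f' 0‖ ≤ E * |t|) {s : ℝ} (hs0 : 0 ≤ s) (hs : s ≤ a) :
    ‖f s - f 0 - s * f' 0‖ ≤ E / 2 * s ^ 2 := by
  have hg : ∀ t : ℝ, HasDerivAt (fun t : ℝ => f t - f 0 - t * f' 0) (f' t - f' 0) t := by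
    intro t
    refine HasDerivAt.congr_deriv (((hf t).sub_const (f 0)).sub
      ((hasDerivAt_id t).ofReal_comp.mul_const (f' 0))) ?_
    simp
  have hB : ∀ t : ℝ, HasDerivAt (fun t : ℝ => E / 2 * t ^ 2) (E * t) t := by
    intro t
    refine HasDerivAt.congr_deriv ((hasDerivAt_pow 2 t).const_mul (E / 2)) ?_
    simp; ring
  refine image_norm_le_of_norm_deriv_right_le_deriv_boundary (a := 0) (b := s)
    (f := fun t : ℝ => f t - f 0 - t * f' 0) (f' := fun t => f' t - f' 0)
    (fun t _ => (hg t).continuousAt.continuousWithinAt)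
    (fun t _ => (hg t).hasDerivWithinAt) (by simp) hB (fun t ht => ?_) ⟨hs0, le_rfl⟩
  have := hf' t (by rw [abs_of_nonneg ht.1]; linarith [ht.2])
  rwa [abs_of_nonneg ht.1] at this

lemma norm_taylor_le_of_lipschitz {f f' : ℝ → ℂ} {E a : ℝ} (hf : ∀ t, HasDerivAt f (f' t) t)
    (hf' : ∀ t, |t| ≤ a → ‖f' t - f' 0‖ ≤ E * |t|) {s : ℝ} (hs : |s| ≤ a) :
    ‖f s - f 0 - s * f' 0‖ ≤ E / 2 * s ^ 2 := by
  rcases le_total 0 s with h | h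
  · exact norm_taylor_le_of_nonneg hf hf' h (by rwa [abs_of_nonneg h] at hs)
  · have := norm_taylor_le_of_nonneg (f := fun t => f (-t)) (f' := fun t => -f' (-t)) (E := E)
      (a := a) (s := -s)
      (fun t => ((hf (-t)).scomp t (hasDerivAt_neg t)).congr_deriv (by simp))
      (fun t ht => by
        have := hf' (-t) (by rwa [abs_neg])
        rw [abs_neg] at this
        rw [neg_zero, neg_sub_neg, norm_sub_rev]
        exact this) (by linarith) (by rwa [abs_of_nonpos h] at hs)
    simpa using this

lemma norm_taylor_le {f f' f'' : ℝ → ℂ} {E a : ℝ} (hf : ∀ t, HasDerivAt f (f' t) t)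
    (hf' : ∀ t, HasDerivAt f' (f'' t) t) (hE : ∀ t, |t| ≤ a → ‖f'' t‖ ≤ E) {s : ℝ}
    (hs : |s| ≤ a) : ‖f s - f 0 - s * f' 0‖ ≤ E / 2 * s ^ 2 := by
  refine norm_taylor_le_of_lipschitz hf (fun t ht => ?_) hs
  have := (convex_Icc (-a) a).norm_image_sub_le_of_norm_hasDerivWithin_le (f := f') (f' := f'')
    (C := E) (x := 0) (y := t) (fun x _ => (hf' x).hasDerivWithinAt)
    (fun x hx => hE x (abs_le.2 hx)) ⟨by linarith [abs_nonneg t], by linarith [abs_nonneg t]⟩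
    (abs_le.1 ht)
  simpa using this

/-! ### The dual certificate on the line -/

section Certificate

variable {ι : Type*} {N : ℕ} {τ : ι → ℝ} [Fintype ι]

lemma interp_eq_filter_add (α β : ι → ℂ) (p : ι → Prop) [DecidablePred p] (t : ℝ) :
    interp N τ α β Finset.univ t = interp N τ α β (Finset.univ.filter p) t
      + interp N τ α β (Finset.univ.filter fun k => ¬ p k) t :=
  (Finset.sum_filter_add_sum_filter_not _ _ _).symm

lemma interp''_eq_filter_add (α β : ι → ℂ) (p : ι → Prop) [DecidablePred p] (t : ℝ) :
    interp'' N τ α β Finset.univ t = interp'' N τ α β (Finset.univ.filter p) t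
      + interp'' N τ α β (Finset.univ.filter fun k => ¬ p k) t :=
  (Finset.sum_filter_add_sum_filter_not _ _ _).symm

variable [DecidableEq ι]

lemma card_erase_red_lt_one_le_one (hτ : SepMod N τ) {t : ℝ} {j : ι}
    (hj : |red N (t - τ j)| ≤ 1 / 2) :
    ((Finset.univ.erase j).filter fun k => |red N (t - τ k)| < 1).card ≤ 1 :=
  card_abs_lt_one_le_one (r := fun k => red N (t - τ k))
    (fun _ _ _ _ hkl => hτ.red_sub_red t hkl) hj
    (fun _ hk => hτ.red_sub_red t (Finset.ne_of_mem_erase hk))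

lemma le_abs_red_erase (hτ : SepMod N τ) {t x : ℝ} {j : ι}
    (hj : |red N (t - τ j)| ≤ 1 - x) :
    ∀ k ∈ Finset.univ.erase j, x ≤ |red N (t - τ k)| := by
  intro k hk
  have h1 := hτ.red_sub_red t (Finset.ne_of_mem_erase hk)
  have h2 := abs_sub (red N (t - τ k)) (red N (t - τ j))
  linarith

lemma certificate_coeff_le (hN : 64 ≤ N) (hτ : SepMod N τ) {α β v : ι → ℂ} (hv1 : ‖v‖ ≤ 1)
    (hv : ∀ j, interp N τ α β Finset.univ (τ j) = v j)
    (hw : ∀ j, interp' N τ α β Finset.univ (τ j) = 0) :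
    ‖α‖ ≤ 1.033 ∧ ‖β‖ ≤ 0.272 ∧ ∀ j, ‖v j - α j‖ ≤ 0.033 := by
  obtain ⟨h1, h2, h3⟩ := norm_coeff_sub_le (w := 0) hN hτ hv hw
  rw [norm_zero] at h3
  have ha : ‖α‖ ≤ 1.0321 := by linarith
  have hb : ‖β‖ ≤ 0.2711 := by linarith
  exact ⟨by linarith, by linarith, fun j => by linarith [h1 j]⟩

lemma one_div_pi_le : 1 / Real.pi ≤ 0.3185 := by
  rw [div_le_iff₀ Real.pi_pos]; linarith [Real.pi_gt_d2]

theorem norm_certificate_near_le (hN : 64 ≤ N) (hτ : SepMod N τ) {α β v : ι → ℂ}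
    (hv1 : ‖v‖ ≤ 1) (hv : ∀ j, interp N τ α β Finset.univ (τ j) = v j)
    (hw : ∀ j, interp' N τ α β Finset.univ (τ j) = 0) (j : ι) {s : ℝ} (hs : |s| ≤ 1 / 5) :
    ‖interp N τ α β Finset.univ (τ j + s)‖ ≤ 1 - s ^ 2 := by
  have hN0 : N ≠ 0 := by omega
  obtain ⟨hA, hB, hC⟩ := certificate_coeff_le hN hτ hv1 hv hw
  set h : ℝ → ℂ := fun x => interp N τ α β (Finset.univ.erase j) (τ j + x) with hh
  set h' : ℝ → ℂ := fun x => interp' N τ α β (Finset.univ.erase j) (τ j + x) with hh'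
  have d1 : ∀ x, HasDerivAt h (h' x) x := fun x =>
    (hasDerivAt_interp hN0 α β _ (τ j + x)).comp_const_add (τ j) x
  have d2 : ∀ x, HasDerivAt h' (interp'' N τ α β (Finset.univ.erase j) (τ j + x)) x := fun x =>
    (hasDerivAt_interp' hN0 α β _ (τ j + x)).comp_const_add (τ j) x
  have hE : ∀ x : ℝ, |x| ≤ 1 / 5 →
      ‖interp'' N τ α β (Finset.univ.erase j) (τ j + x)‖ ≤ 7.7 := by
    intro x hx
    have hr : red N (τ j + x - τ j) = x := by
      rw [add_sub_cancel_left]; exact red_of_abs_le (by omega) (by linarith)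
    obtain ⟨-, -, e⟩ := norm_interp_le_of_le hN hτ (α := α) (β := β) (t := τ j + x)
      (T := Finset.univ.erase j) (A := 1.033) (B := 0.272) (x := 0.8) (n := 1)
      (X := 0.40323) (P₃ := 0.14957) (P₄ := 0.05044) (by norm_num) (by norm_num)
      (fun k _ => (norm_le_pi_norm α k).trans hA) (fun k _ => (norm_le_pi_norm β k).trans hB)
      (by norm_num) (by norm_num) (le_abs_red_erase hτ (by rw [hr]; norm_num; linarith))
      (card_erase_red_lt_one_le_one hτ (by rw [hr]; linarith))
      (by norm_num) (by norm_num) (by norm_num)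
    have hp := Real.pi_lt_d4
    have hp0 := Real.pi_gt_three
    have hp2 : Real.pi ^ 2 ≤ 9.87 := by nlinarith
    have hpi := one_div_pi_le
    refine e.trans ?_
    nlinarith
  have hR := norm_taylor_le d1 d2 hE hs
  have h0 : h 0 = v j - α j := by
    rw [← hv j, interp_node hN0, add_sub_cancel_left, hh]; simp
  have h0' : h' 0 = -β j := by
    have := hw j
    rw [interp'_node hN0] at this
    rw [hh', eq_neg_iff_add_eq_zero, add_comm]
    simpa using this
  have key : interp N τ α β Finset.univ (τ j + s) = v j * ker N s + (1 - ker N s) * h 0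
      + (h s - h 0 - s * h' 0) + h' 0 * ((s * (1 - ker N s) + (s - oddN N s) * ker N s : ℝ)) := by
    rw [interp_univ_eq α β j, add_sub_cancel_left, oker, h0', h0]
    change _ + h s = _
    push_cast; ring
  have k0 := ker_nonneg N s
  have k1 := ker_le_near hN hs
  have k2 := ker_le_one N s
  have t1 : ‖v j * ker N s‖ ≤ ker N s := by
    rw [norm_mul, Complex.norm_real, Real.norm_of_nonneg k0]
    exact mul_le_of_le_one_left k0 ((norm_le_pi_norm v j).trans hv1)
  have t2 : ‖(1 - (ker N s : ℂ)) * h 0‖ ≤ (1 - ker N s) * 0.033 := by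
    have : (1 - (ker N s : ℂ)) = ((1 - ker N s : ℝ) : ℂ) := by push_cast; rfl
    rw [this, norm_mul, Complex.norm_real, Real.norm_of_nonneg (by linarith), h0]
    exact mul_le_mul_of_nonneg_left (hC j) (by linarith)
  have s0 := abs_nonneg s
  have t3 : |s * (1 - ker N s) + (s - oddN N s) * ker N s|
      ≤ 0.2 * (1 - ker N s) + 0.0004 * s ^ 2 := by
    refine (abs_add_le _ _).trans (add_le_add ?_ ?_)
    · rw [abs_mul, abs_of_nonneg (by linarith : 0 ≤ 1 - ker N s)]
      exact mul_le_mul_of_nonneg_right (by linarith) (by linarith)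
    · rw [abs_mul, abs_of_nonneg k0]
      refine (mul_le_of_le_one_right (abs_nonneg _) k2).trans ((abs_sub_oddN_le hN s).trans ?_)
      rw [← sq_abs s]
      nlinarith [sq_nonneg |s|]
  have t4 : ‖h' 0 * ((s * (1 - ker N s) + (s - oddN N s) * ker N s : ℝ))‖
      ≤ 0.272 * (0.2 * (1 - ker N s) + 0.0004 * s ^ 2) := by
    rw [norm_mul, Complex.norm_real, h0', norm_neg]
    exact mul_le_mul ((norm_le_pi_norm β j).trans hB) t3 (norm_nonneg _) (by norm_num)
  rw [key]
  refine (norm_add_le _ _).trans ((add_le_add ((norm_add_le _ _).trans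
    (add_le_add ((norm_add_le _ _).trans (add_le_add t1 t2)) hR)) t4).trans ?_)
  nlinarith [sq_nonneg s]

lemma abs_oddN_le_abs_red (hN : N ≠ 0) (t : ℝ) : |oddN N t| ≤ |red N t| := by
  have hN' : (0 : ℝ) < N := by exact_mod_cast Nat.pos_of_ne_zero hN
  refine (abs_oddN_le N t).trans ?_
  rw [← abs_chord_red hN, div_le_iff₀ Real.pi_pos, chord, abs_mul, abs_of_pos hN']
  have := Real.abs_sin_le_abs (x := Real.pi * red N t / N)
  rw [abs_div, abs_mul, abs_of_pos Real.pi_pos, abs_of_pos hN', le_div_iff₀ hN'] at this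
  linarith

lemma norm_own_term_le (hN : N ≠ 0) {t c A B : ℝ} (hA0 : 0 ≤ A) (hB0 : 0 ≤ B) {a b : ℂ}
    (ha : ‖a‖ ≤ A) (hb : ‖b‖ ≤ B) (hc : ker N (red N t) ≤ c) :
    ‖a * ker N t + b * oker N t‖ ≤ A * c + B * (|red N t| * c) := by
  rw [ker_red hN] at hc
  have k0 := ker_nonneg N t
  have ho := abs_oddN_le_abs_red hN t
  refine (norm_add_le _ _).trans (add_le_add ?_ ?_)
  · rw [norm_mul, Complex.norm_real, Real.norm_of_nonneg k0]
    exact mul_le_mul ha hc k0 hA0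
  · rw [norm_mul, Complex.norm_real, oker, norm_mul, Real.norm_of_nonneg k0]
    exact mul_le_mul hb (mul_le_mul ho hc k0 (abs_nonneg _)) (by positivity) hB0

theorem norm_certificate_far_le (hN : 64 ≤ N) (hτ : SepMod N τ) {α β v : ι → ℂ}
    (hv1 : ‖v‖ ≤ 1) (hv : ∀ j, interp N τ α β Finset.univ (τ j) = v j)
    (hw : ∀ j, interp' N τ α β Finset.univ (τ j) = 0) {t : ℝ}
    (ht : ∀ j, 1 / 5 ≤ |red N (t - τ j)|) :
    ‖interp N τ α β Finset.univ t‖ ≤ 0.97 := by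
  have hN0 : N ≠ 0 := by omega
  obtain ⟨hA, hB, -⟩ := certificate_coeff_le hN hτ hv1 hv hw
  have hpi := one_div_pi_le
  have hα : ∀ k, ‖α k‖ ≤ 1.033 := fun k => (norm_le_pi_norm α k).trans hA
  have hβ : ∀ k, ‖β k‖ ≤ 0.272 := fun k => (norm_le_pi_norm β k).trans hB
  by_cases hnear : ∃ j, |red N (t - τ j)| ≤ 1 / 2
  · obtain ⟨j, hj⟩ := hnear
    rw [interp_univ_eq α β j]
    refine (norm_add_le _ _).trans ?_
    rcases le_total |red N (t - τ j)| (3 / 10) with h3 | h3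
    · have o := norm_own_term_le hN0 (by norm_num) (by norm_num) (hα j) (hβ j)
        (ker_le_of_one_fifth_le hN (ht j) hj)
      obtain ⟨e, -, -⟩ := norm_interp_le_of_le hN hτ (α := α) (β := β) (t := t)
        (T := Finset.univ.erase j) (A := 1.033) (B := 0.272) (x := 0.7) (n := 1)
        (X := 1) (P₃ := 0.182) (P₄ := 0.0692) (by norm_num) (by norm_num)
        (fun k _ => hα k) (fun k _ => hβ k) (by norm_num) (by norm_num)
        (le_abs_red_erase hτ (by norm_num; linarith))
        (card_erase_red_lt_one_le_one hτ hj) (by norm_num) (by norm_num) (by norm_num)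
      linarith
    · have o := norm_own_term_le hN0 (by norm_num) (by norm_num) (hα j) (hβ j)
        (ker_le_of_three_tenths_le hN h3 hj)
      obtain ⟨e, -, -⟩ := norm_interp_le_of_le hN hτ (α := α) (β := β) (t := t)
        (T := Finset.univ.erase j) (A := 1.033) (B := 0.272) (x := 0.5) (n := 1)
        (X := 1) (P₃ := 0.353) (P₄ := 0.198) (by norm_num) (by norm_num)
        (fun k _ => hα k) (fun k _ => hβ k) (by norm_num) (by norm_num)
        (le_abs_red_erase hτ (by norm_num; linarith))
        (card_erase_red_lt_one_le_one hτ hj) (by norm_num) (by norm_num) (by norm_num)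
      linarith
  · push Not at hnear
    obtain ⟨e, -, -⟩ := norm_interp_le_of_le hN hτ (α := α) (β := β) (t := t)
      (T := Finset.univ) (A := 1.033) (B := 0.272) (x := 0.5) (n := 2)
      (X := 1) (P₃ := 0.622) (P₄ := 0.371) (by norm_num) (by norm_num)
      (fun k _ => hα k) (fun k _ => hβ k) (by norm_num) (by norm_num)
      (fun k _ => by have := hnear k; norm_num at this ⊢; exact this.le)
      (card_abs_lt_one_le_two fun _ _ _ _ hkl => hτ.red_sub_red t hkl)
      (by norm_num) (by norm_num) (by norm_num)
    linarith

/-! ### Global bounds for interpolating sums -/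

lemma abs_oker''_le (hN : 64 ≤ N) {t : ℝ} (ht : |red N t| ≤ 1) : |oker'' N t| ≤ 190 := by
  have h0 := (abs_oddN_le_abs_red (by omega : N ≠ 0) t).trans ht
  have h1 := abs_oddN''_le hN t
  have k0 := ker_nonneg N t
  have k1 := ker_le_one N t
  have hp := Real.pi_lt_d2
  have hp0 := Real.pi_pos
  have e1 : |oddN'' N t * ker N t| ≤ 1 := by
    rw [abs_mul, abs_of_nonneg k0]
    exact mul_le_one₀ (by linarith) k0 k1
  have e2 : |2 * oddN' N t * ker' N t| ≤ 2 * (4 * Real.pi) := by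
    rw [abs_mul, abs_mul, abs_of_pos (by norm_num : (0 : ℝ) < 2)]
    exact mul_le_mul (by linarith [abs_oddN'_le N t]) (abs_ker'_le N t) (abs_nonneg _)
      (by norm_num)
  have e3 : |oddN N t * ker'' N t| ≤ 16 * Real.pi ^ 2 := by
    rw [abs_mul]
    exact (mul_le_of_le_one_left (abs_nonneg _) h0).trans (abs_ker''_le N t)
  refine (abs_add_le _ _).trans ((add_le_add ((abs_add_le _ _).trans (add_le_add e1 e2)) e3).trans
    ?_)
  nlinarith

theorem interp_coeff_le (hN : 64 ≤ N) (hτ : SepMod N τ) {α β v w : ι → ℂ}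
    (hv : ∀ j, interp N τ α β Finset.univ (τ j) = v j)
    (hw : ∀ j, interp' N τ α β Finset.univ (τ j) = w j) :
    ‖α‖ ≤ 2 * (‖v‖ + ‖w‖) ∧ ‖β‖ ≤ 2 * (‖v‖ + ‖w‖) := by
  obtain ⟨-, h2, h3⟩ := norm_coeff_sub_le hN hτ hv hw
  have := norm_nonneg v
  have := norm_nonneg w
  have := norm_nonneg α
  have := norm_nonneg β
  constructor <;> linarith

end Certificate

section Global

variable {ι : Type*} {N : ℕ} {τ : ι → ℝ} [Fintype ι]

theorem norm_interp_le (hN : 64 ≤ N) (hτ : SepMod N τ) {α β : ι → ℂ} {Y : ℝ} (hY : 0 ≤ Y)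
    (hα : ‖α‖ ≤ Y) (hβ : ‖β‖ ≤ Y) (t : ℝ) :
    ‖interp N τ α β Finset.univ t‖ ≤ 5 * Y ∧ ‖interp'' N τ α β Finset.univ t‖ ≤ 800 * Y := by
  have hN0 : N ≠ 0 := by omega
  have hα' : ∀ k, ‖α k‖ ≤ Y := fun k => (norm_le_pi_norm α k).trans hα
  have hβ' : ∀ k, ‖β k‖ ≤ Y := fun k => (norm_le_pi_norm β k).trans hβ
  let p : ι → Prop := fun k => |red N (t - τ k)| < 1
  have hcard : (Finset.univ.filter p).card ≤ 2 :=
    card_abs_lt_one_le_two fun _ _ _ _ hkl => hτ.red_sub_red t hkl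
  have hcard' : ((Finset.univ.filter p).card : ℝ) ≤ 2 := by exact_mod_cast hcard
  have hfar : ∀ k ∈ Finset.univ.filter fun k => ¬ p k, (1 : ℝ) ≤ |red N (t - τ k)| :=
    fun k hk => not_lt.1 (Finset.mem_filter.1 hk).2
  obtain ⟨e1, -, e2⟩ := norm_interp_le_of_le hN hτ (α := α) (β := β) (t := t)
    (T := Finset.univ.filter fun k => ¬ p k) (A := Y) (B := Y) (x := 1) (n := 0)
    (X := 1) (P₃ := 0.084) (P₄ := 0.024) hY hY
    (fun k _ => hα' k) (fun k _ => hβ' k) (by norm_num) (by norm_num) hfar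
    (by
      rw [Nat.le_zero, Finset.card_eq_zero, Finset.filter_eq_empty_iff]
      exact fun k hk => not_lt.2 (hfar k hk)) (by norm_num) (by norm_num) (by norm_num)
  have hpi := one_div_pi_le
  have hp := Real.pi_lt_d2
  have hp0 := Real.pi_pos
  have hp2 : Real.pi ^ 2 ≤ 10 := by nlinarith
  constructor
  · rw [interp_eq_filter_add α β p]
    have e3 : ‖interp N τ α β (Finset.univ.filter p) t‖ ≤ 2 * (2 * Y) := by
      refine (norm_sum_le_of_le (f := fun k => α k * ker N (t - τ k) + β k * oker N (t - τ k))
        (n := fun _ => 2 * Y) _ fun k hk => ?_).trans ?_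
      · have hk' : |red N (t - τ k)| < 1 := (Finset.mem_filter.1 hk).2
        have h1 := norm_own_term_le hN0 hY hY (hα' k) (hβ' k) (ker_le_one N (red N (t - τ k)))
        nlinarith
      · rw [Finset.sum_const, nsmul_eq_mul]
        exact mul_le_mul_of_nonneg_right hcard' (by linarith)
    refine (norm_add_le _ _).trans ((add_le_add e3 e1).trans ?_)
    nlinarith
  · rw [interp''_eq_filter_add α β p]
    have e3 : ‖interp'' N τ α β (Finset.univ.filter p) t‖ ≤ 2 * (350 * Y) := by
      refine (norm_sum_le_of_le (f := fun k => α k * ker'' N (t - τ k) + β k * oker'' N (t - τ k))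
        (n := fun _ => 350 * Y) _ fun k hk => ?_).trans ?_
      · have hk' : |red N (t - τ k)| < 1 := (Finset.mem_filter.1 hk).2
        refine (norm_add_le _ _).trans ?_
        rw [norm_mul, norm_mul, Complex.norm_real, Complex.norm_real]
        have h1 := mul_le_mul (hα' k) ((abs_ker''_le N (t - τ k)).trans
          (by linarith : _ ≤ (160 : ℝ))) (abs_nonneg _) hY
        have h2 := mul_le_mul (hβ' k) (abs_oker''_le hN hk'.le) (abs_nonneg _) hY
        simp only [Real.norm_eq_abs]
        linarith
      · rw [Finset.sum_const, nsmul_eq_mul]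
        exact mul_le_mul_of_nonneg_right hcard' (by linarith)
    refine (norm_add_le _ _).trans ((add_le_add e3 e2).trans ?_)
    have f1 : 4 * Real.pi ^ 2 * (1 + 8 / 3 * 1 + 5 * 1 ^ 2) * 0.024 ≤ 10 := by linarith
    have f2 : (1 / 100 * (1 / Real.pi) + 4 * Real.pi * (1 + 8 / 3 * 1 + 5 * 1 ^ 2)) * 0.084
        + 8 * Real.pi * (1 / 3 + 1) * 0.024 ≤ 20 := by linarith
    have g1 := mul_le_mul_of_nonneg_left f1 hY
    have g2 := mul_le_mul_of_nonneg_left f2 hY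
    linarith

end Global

/-! ### The kernels as trigonometric polynomials -/

lemma exists_trigPoly_cos {n : ℕ} {m : ℤ} (hm : |m| ≤ n) :
    ∃ f ∈ trigPoly n, ∀ x : ℝ, f (x : Torus) = (Real.cos (2 * Real.pi * m * x) : ℝ) := by
  refine ⟨(1 / 2 : ℂ) • ((fun x => (fourier m x : ℂ)) + fun x => (fourier (-m) x : ℂ)),
    Submodule.smul_mem _ _ (Submodule.add_mem _ (fourier_mem_trigPoly hm)
      (fourier_mem_trigPoly (by rwa [abs_neg]))), fun x => ?_⟩
  simp only [Pi.smul_apply, Pi.add_apply, smul_eq_mul, fourier_coe_apply]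
  push_cast
  rw [Complex.cos]
  ring_nf

lemma exists_trigPoly_sin :
    ∃ f ∈ trigPoly 1, ∀ x : ℝ, f (x : Torus) = (Real.sin (2 * Real.pi * x) : ℝ) := by
  refine ⟨(-Complex.I / 2 : ℂ) • ((fun x => (fourier 1 x : ℂ)) - fun x => (fourier (-1) x : ℂ)),
    Submodule.smul_mem _ _ (Submodule.sub_mem _ (fourier_mem_trigPoly (by simp))
      (fourier_mem_trigPoly (by simp))), fun x => ?_⟩
  simp only [Pi.smul_apply, Pi.sub_apply, smul_eq_mul, fourier_coe_apply]
  push_cast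
  rw [Complex.sin]
  ring_nf

lemma exists_trigPoly_dir_sq {N : ℕ} (hN : N ≠ 0) :
    ∃ f ∈ trigPoly (N - 1), ∀ x : ℝ, f (x : Torus) = (dir N (N * x) ^ 2 : ℝ) := by
  have hN' : (N : ℝ) ≠ 0 := by exact_mod_cast hN
  have h : ∀ k l : ℕ, ∃ f ∈ trigPoly (N - 1), k < N → l < N → ∀ x : ℝ, f (x : Torus)
      = (Real.cos (dirFreq N k * (N * x)) * Real.cos (dirFreq N l * (N * x)) : ℝ) := by
    intro k l
    by_cases hkl : k < N ∧ l < N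
    · obtain ⟨f, hf, hfx⟩ := exists_trigPoly_cos (n := N - 1) (m := (k : ℤ) + l + 1 - N)
        (by rw [abs_le]; omega)
      obtain ⟨g, hg, hgx⟩ := exists_trigPoly_cos (n := N - 1) (m := (k : ℤ) - l)
        (by rw [abs_le]; omega)
      refine ⟨(1 / 2 : ℂ) • (f + g), Submodule.smul_mem _ _ (Submodule.add_mem _ hf hg),
        fun _ _ x => ?_⟩
      simp only [Pi.smul_apply, Pi.add_apply, hfx, hgx, smul_eq_mul]
      have e1 : 2 * Real.pi * (((k : ℤ) + l + 1 - N : ℤ) : ℝ) * x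
          = dirFreq N k * (N * x) + dirFreq N l * (N * x) := by
        simp only [dirFreq]; push_cast; field_simp; ring
      have e2 : 2 * Real.pi * (((k : ℤ) - l : ℤ) : ℝ) * x
          = dirFreq N k * (N * x) - dirFreq N l * (N * x) := by
        simp only [dirFreq]; push_cast; field_simp; ring
      rw [e1, e2, Real.cos_add, Real.cos_sub]
      push_cast; ring
    · exact ⟨0, Submodule.zero_mem _, fun hk hl => absurd ⟨hk, hl⟩ hkl⟩
  choose F hF hFx using h
  refine ⟨(1 / (N : ℂ) ^ 2) • ∑ k ∈ Finset.range N, ∑ l ∈ Finset.range N, F k l,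
    Submodule.smul_mem _ _ (Submodule.sum_mem _ fun k _ => Submodule.sum_mem _ fun l _ => hF k l),
    fun x => ?_⟩
  simp only [Pi.smul_apply, Finset.sum_apply, smul_eq_mul]
  rw [dir, div_pow, sq (∑ k ∈ _, _), Finset.sum_mul_sum]
  push_cast
  rw [one_div, div_eq_inv_mul]
  congr 1
  refine Finset.sum_congr rfl fun k hk => Finset.sum_congr rfl fun l hl => ?_
  rw [hFx k l (Finset.mem_range.1 hk) (Finset.mem_range.1 hl)]
  push_cast; rfl

lemma exists_trigPoly_ker {N : ℕ} (hN : N ≠ 0) :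
    ∃ f ∈ trigPoly (2 * N - 2), ∀ x : ℝ, f (x : Torus) = (ker N (N * x) : ℝ) := by
  obtain ⟨f, hf, hfx⟩ := exists_trigPoly_dir_sq hN
  refine ⟨f * f, ?_, fun x => ?_⟩
  · have := mul_mem_trigPoly hf hf
    rwa [show N - 1 + (N - 1) = 2 * N - 2 by omega] at this
  · rw [Pi.mul_apply, hfx, ker]; push_cast; ring

lemma exists_trigPoly_oker {N : ℕ} (hN : N ≠ 0) :
    ∃ f ∈ trigPoly (2 * N - 1), ∀ x : ℝ, f (x : Torus) = (oker N (N * x) : ℝ) := by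
  have hN' : (N : ℝ) ≠ 0 := by exact_mod_cast hN
  obtain ⟨f, hf, hfx⟩ := exists_trigPoly_ker hN
  obtain ⟨g, hg, hgx⟩ := exists_trigPoly_sin
  refine ⟨((N / (2 * Real.pi) : ℝ) : ℂ) • (g * f), ?_, fun x => ?_⟩
  · have := mul_mem_trigPoly hg hf
    rw [show 1 + (2 * N - 2) = 2 * N - 1 by omega] at this
    exact Submodule.smul_mem _ _ this
  · have e : oddN N (N * x) = N / (2 * Real.pi) * Real.sin (2 * Real.pi * x) := by
      have e1 : Real.pi * (N * x) / N = Real.pi * x := by field_simp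
      rw [oddN, chord, cosN, e1, mul_assoc 2, Real.sin_two_mul]
      have := Real.pi_ne_zero
      field_simp
    rw [Pi.smul_apply, Pi.mul_apply, hfx, hgx, oker, e, smul_eq_mul]
    push_cast; ring

lemma exists_trigPoly_interp {ι : Type*} [Fintype ι] {N M : ℕ} (hN : N ≠ 0)
    (hM : 2 * N - 1 ≤ M) (σ : ι → ℝ) (α β : ι → ℂ) :
    ∃ f ∈ trigPoly M, ∀ x : ℝ, f (x : Torus)
      = interp N (fun j => N * σ j) α β Finset.univ (N * x) := by
  obtain ⟨f, hf, hfx⟩ := exists_trigPoly_ker hN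
  obtain ⟨g, hg, hgx⟩ := exists_trigPoly_oker hN
  refine ⟨∑ j, (α j • (fun x => f (x - (σ j : Torus))) + β j • fun x => g (x - (σ j : Torus))),
    Submodule.sum_mem _ fun j _ => Submodule.add_mem _
      (Submodule.smul_mem _ _ (comp_sub_mem_trigPoly (trigPoly_mono (by omega) hf) _))
      (Submodule.smul_mem _ _ (comp_sub_mem_trigPoly (trigPoly_mono hM hg) _)), fun x => ?_⟩
  simp only [Finset.sum_apply, Pi.add_apply, Pi.smul_apply, smul_eq_mul, interp]
  refine Finset.sum_congr rfl fun j _ => ?_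
  rw [← AddCircle.coe_sub, hfx, hgx, mul_sub]

/-! ### Functions on the torus -/

lemma hasDerivAt_torus {K : Torus → ℂ} (hK : TorusDifferentiable K) (z : Torus) (t : ℝ) :
    HasDerivAt (fun u : ℝ => K (z + (u : Torus))) (torusDeriv K (z + (t : Torus))) t := by
  have h := (hK (z + (t : Torus))).hasDerivAt
  have h' : HasDerivAt (fun u : ℝ => K (z + (t : Torus) + (u : Torus)))
      (torusDeriv K (z + (t : Torus))) (t - t) := by rwa [sub_self]
  have h2 := h'.comp_sub_const t t
  have e : (fun x : ℝ => K (z + (t : Torus) + ((x - t : ℝ) : Torus)))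
      = fun u : ℝ => K (z + (u : Torus)) := by
    funext u
    rw [AddCircle.coe_sub]; congr 1; abel
  rwa [e] at h2

lemma continuous_of_torusDifferentiable {K : Torus → ℂ} (hK : TorusDifferentiable K) :
    Continuous K := by
  refine isQuotientMap_quotient_mk'.continuous_iff.2 ?_
  refine continuous_iff_continuousAt.2 fun t => ?_
  have := (hasDerivAt_torus hK 0 t).continuousAt
  simp only [zero_add] at this
  exact this

lemma enorm_le_eLpNorm_top {g : Torus → ℂ} (hg : Continuous g) (x : Torus) :
    ‖g x‖ₑ ≤ eLpNorm g ∞ volume := by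
  have h : ∀ᵐ x, ‖g x‖ₑ ≤ eLpNorm g ∞ volume := by
    rw [eLpNorm_exponent_top]; exact ae_le_eLpNormEssSup
  have hd := Measure.dense_of_ae h
  have hc : IsClosed {x | ‖g x‖ₑ ≤ eLpNorm g ∞ volume} :=
    isClosed_le hg.enorm continuous_const
  have := hc.closure_eq ▸ hd.closure_eq
  exact (this ▸ Set.mem_univ x : x ∈ {x | ‖g x‖ₑ ≤ eLpNorm g ∞ volume})

lemma eLpNorm_top_ne_top {g : Torus → ℂ} (hg : Continuous g) : eLpNorm g ∞ volume ≠ ∞ := by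
  obtain ⟨C, hC⟩ := (isCompact_univ.image hg.norm).bddAbove
  refine ((eLpNormEssSup_le_of_ae_bound (C := C)
    (Filter.Eventually.of_forall fun x => hC ⟨x, trivial, rfl⟩)).trans_lt
    ENNReal.ofReal_lt_top).ne

lemma norm_le_toReal_eLpNorm_top {g : Torus → ℂ} (hg : Continuous g) (x : Torus) :
    ‖g x‖ ≤ (eLpNorm g ∞ volume).toReal := by
  rw [← toReal_enorm]
  exact ENNReal.toReal_mono (eLpNorm_top_ne_top hg) (enorm_le_eLpNorm_top hg x)

lemma ae_torus_add {p : Torus → Prop} (h : ∀ᵐ x : Torus, p x) (z : Torus) :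
    ∀ᵐ u : ℝ, p (z + (u : Torus)) := by
  have h1 : ∀ᵐ u : ℝ, p (u : Torus) := by
    have h2 : ∀ n : ℤ, ∀ᵐ u : ℝ ∂(volume.restrict (Set.Ioc (n : ℝ) (n + 1))), p (u : Torus) :=
      fun n => (AddCircle.measurePreserving_mk 1 (n : ℝ)).quasiMeasurePreserving.ae h
    have h3 := (ae_restrict_iUnion_iff (μ := volume) (fun n : ℤ => Set.Ioc (n : ℝ) (n + 1))
      fun u : ℝ => p (u : Torus)).2 h2
    rwa [iUnion_Ioc_intCast, Measure.restrict_univ] at h3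
  obtain ⟨c, rfl⟩ := QuotientAddGroup.mk_surjective z
  have := (measurePreserving_add_left volume c).quasiMeasurePreserving.ae h1
  filter_upwards [this] with u hu
  simpa using hu

lemma norm_sub_le_of_ae_bound {K : Torus → ℂ} (hK : TorusDifferentiable K)
    (hK' : MemLp (torusDeriv K) ∞ volume) (z : Torus) (t : ℝ) :
    ‖K (z + (t : Torus)) - K z‖ ≤ (eLpNorm (torusDeriv K) ∞ volume).toReal * |t| := by
  set L := (eLpNorm (torusDeriv K) ∞ volume).toReal
  have h1 : ∀ᵐ x : Torus, ‖torusDeriv K x‖ ≤ L := by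
    have : ∀ᵐ x : Torus, ‖torusDeriv K x‖ₑ ≤ eLpNorm (torusDeriv K) ∞ volume := by
      rw [eLpNorm_exponent_top]; exact ae_le_eLpNormEssSup
    filter_upwards [this] with x hx
    rw [← toReal_enorm]
    exact ENNReal.toReal_mono hK'.2.ne hx
  have h2 := ae_torus_add h1 z
  have hd : (fun u : ℝ => torusDeriv K (z + (u : Torus)))
      = deriv fun u : ℝ => K (z + (u : Torus)) :=
    funext fun u => (hasDerivAt_torus hK z u).deriv.symm
  have hm : StronglyMeasurable fun u : ℝ => torusDeriv K (z + (u : Torus)) := by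
    rw [hd]; exact stronglyMeasurable_deriv _
  have hi : IntervalIntegrable (fun u : ℝ => torusDeriv K (z + (u : Torus))) volume 0 t := by
    have : IsFiniteMeasure (volume.restrict (Set.uIoc 0 t)) := ⟨by simp [Set.uIoc]⟩
    rw [intervalIntegrable_iff]
    exact Integrable.of_bound hm.aestronglyMeasurable L (ae_restrict_of_ae h2)
  have h3 := intervalIntegral.integral_eq_sub_of_hasDerivAt
    (fun u _ => hasDerivAt_torus hK z u) hi
  rw [AddCircle.coe_zero, add_zero] at h3
  rw [← h3]
  have := intervalIntegral.norm_integral_le_of_norm_le_const_ae (a := 0) (b := t) (C := L)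
    (f := fun u : ℝ => torusDeriv K (z + (u : Torus)))
    (by filter_upwards [h2] with u hu _ using hu)
  rwa [sub_zero] at this

/-! ### Interpolation on the torus -/

lemma sepMod_of_minSeparation {M N : ℕ} (hM : 0 < M) (hMN : M ≤ 2 * N) {S : Finset Torus}
    (hS : MinSeparation M S) {σ : Torus → ℝ} (hσ : ∀ s, (σ s : Torus) = s) :
    SepMod N fun j : S => N * σ j := by
  intro i j hij n
  have hM' : (0 : ℝ) < M := by exact_mod_cast hM
  have hMN' : (M : ℝ) ≤ 2 * N := by exact_mod_cast hMN
  have h := hS i i.2 j j.2 (fun h => hij (Subtype.ext h))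
  rw [dist_eq_norm, ← hσ i, ← hσ j, ← AddCircle.coe_sub, UnitAddCircle.norm_eq] at h
  have h2 := h.trans (round_le (σ i - σ j) n)
  have e : N * σ i - N * σ j - n * N = N * (σ i - σ j - n) := by ring
  simp only
  rw [e, abs_mul, Nat.abs_cast]
  rw [div_le_iff₀ hM'] at h2
  nlinarith [abs_nonneg (σ i - σ j - n)]

/-- On the torus, `x` is `c` translated by the reduced coordinate of `x` relative to `c`. -/
lemma coe_eq_of_red {N : ℕ} (hN : N ≠ 0) (x c : ℝ) :
    (x : Torus) = ((c + red N (N * x - N * c) / N : ℝ) : Torus) := by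
  have hN' : (N : ℝ) ≠ 0 := by exact_mod_cast hN
  have e : c + red N (N * x - N * c) / N = x - round ((N * x - N * c) / N) := by
    rw [red]; field_simp; ring
  rw [e, AddCircle.coe_sub, eq_comm, sub_eq_self, AddCircle.coe_eq_zero_iff]
  exact ⟨round ((N * x - N * c) / N), by simp⟩

section

variable {ι : Type*} [Fintype ι] [DecidableEq ι] {N M : ℕ} {σ : ι → ℝ}

theorem exists_certificate (hN : 64 ≤ N) (hM : 2 * N - 1 ≤ M)
    (hσ : SepMod N fun j => N * σ j) {v : ι → ℂ} (hv : ‖v‖ ≤ 1) :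
    ∃ f ∈ trigPoly M, (∀ j, f (σ j : Torus) = v j) ∧
      (∀ j, ∀ r : ℝ, |r| ≤ 1 / 5 → ‖f ((σ j + r / N : ℝ) : Torus)‖ ≤ 1 - r ^ 2) ∧
      ∀ x : ℝ, (∀ j, 1 / 5 ≤ |red N (N * x - N * σ j)|) → ‖f (x : Torus)‖ ≤ 0.97 := by
  have hN0 : N ≠ 0 := by omega
  have hN' : (N : ℝ) ≠ 0 := by exact_mod_cast hN0
  obtain ⟨α, β, h1, h2⟩ := exists_interp hN hσ v 0
  obtain ⟨f, hf, hfx⟩ := exists_trigPoly_interp hN0 hM σ α β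
  refine ⟨f, hf, fun j => by rw [hfx, h1], fun j r hr => ?_, fun x hx => ?_⟩
  · rw [hfx, mul_add, mul_div_cancel₀ _ hN']
    exact norm_certificate_near_le hN hσ hv h1 h2 j hr
  · rw [hfx]
    exact norm_certificate_far_le hN hσ hv h1 h2 hx

theorem exists_hermite (hN : 64 ≤ N) (hM : 2 * N - 1 ≤ M)
    (hσ : SepMod N fun j => N * σ j) (v w : ι → ℂ) :
    ∃ T ∈ trigPoly M, ∃ F F' F'' : ℝ → ℂ, (∀ x : ℝ, T (x : Torus) = F (N * x)) ∧
      (∀ t, HasDerivAt F (F' t) t) ∧ (∀ t, HasDerivAt F' (F'' t) t) ∧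
      (∀ j, F (N * σ j) = v j) ∧ (∀ j, F' (N * σ j) = w j) ∧
      (∀ t, ‖F t‖ ≤ 10 * (‖v‖ + ‖w‖)) ∧ ∀ t, ‖F'' t‖ ≤ 1600 * (‖v‖ + ‖w‖) := by
  have hN0 : N ≠ 0 := by omega
  obtain ⟨α, β, h1, h2⟩ := exists_interp hN hσ v w
  obtain ⟨f, hf, hfx⟩ := exists_trigPoly_interp hN0 hM σ α β
  obtain ⟨ha, hb⟩ := interp_coeff_le hN hσ h1 h2
  have hY : 0 ≤ 2 * (‖v‖ + ‖w‖) := by positivity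
  refine ⟨f, hf, _, _, _, hfx, hasDerivAt_interp hN0 α β _, hasDerivAt_interp' hN0 α β _, h1, h2,
    fun t => ?_, fun t => ?_⟩
  · linarith [(norm_interp_le hN hσ hY ha hb t).1]
  · linarith [(norm_interp_le hN hσ hY ha hb t).2]

end

lemma norm_sub_hermite_le {N : ℕ} (hN : 0 < N) {K : Torus → ℂ} (hK : TorusDifferentiable K)
    (hK' : TorusDifferentiable (torusDeriv K))
    (hK'' : MemLp (torusDeriv (torusDeriv K)) ∞ volume) {F F' F'' : ℝ → ℂ} {E c : ℝ} {z : Torus}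
    (hF : ∀ t, HasDerivAt F (F' t) t) (hF' : ∀ t, HasDerivAt F' (F'' t) t)
    (hE : ∀ t, ‖F'' t‖ ≤ E) (h0 : F c = K z) (h1 : F' c = -(torusDeriv K z / N)) (r : ℝ) :
    ‖K (z - ((r / N : ℝ) : Torus)) - F (c + r)‖
      ≤ ((eLpNorm (torusDeriv (torusDeriv K)) ∞ volume).toReal / N ^ 2 + E) * r ^ 2 := by
  set L := (eLpNorm (torusDeriv (torusDeriv K)) ∞ volume).toReal
  have hN' : (0 : ℝ) < N := by exact_mod_cast hN
  have hL : 0 ≤ L := ENNReal.toReal_nonneg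
  have hE0 : 0 ≤ E := (norm_nonneg _).trans (hE 0)
  set g : ℝ → ℂ := fun u => K (z + ((-(1 / N) * u : ℝ) : Torus)) - F (c + u) with hg
  set g' : ℝ → ℂ := fun u => -(1 / N : ℝ) * torusDeriv K (z + ((-(1 / N) * u : ℝ) : Torus))
    - F' (c + u) with hg'
  have d : ∀ u, HasDerivAt g (g' u) u := by
    intro u
    have a1 := (hasDerivAt_torus hK z (-(1 / N) * u)).scomp u
      ((hasDerivAt_id u).const_mul (-(1 / N : ℝ)))
    refine HasDerivAt.congr_deriv (a1.sub ((hF (c + u)).comp_const_add c u)) ?_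
    simp [hg', Complex.real_smul]
  have hl : ∀ u, |u| ≤ |r| → ‖g' u - g' 0‖ ≤ (L / N ^ 2 + E) * |u| := by
    intro u _
    have a2 := norm_sub_le_of_ae_bound hK' hK'' z (-(1 / N) * u)
    have a3 := convex_univ.norm_image_sub_le_of_norm_hasDerivWithin_le (f := F') (f' := F'')
      (C := E) (x := c) (y := c + u) (fun x _ => (hF' x).hasDerivWithinAt) (fun x _ => hE x)
      (Set.mem_univ _) (Set.mem_univ _)
    rw [add_sub_cancel_left, Real.norm_eq_abs] at a3
    have e : g' u - g' 0 = -((1 / N : ℝ) * (torusDeriv K (z + ((-(1 / N) * u : ℝ) : Torus))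
        - torusDeriv K z)) - (F' (c + u) - F' c) := by
      simp only [hg', mul_zero, AddCircle.coe_zero, add_zero]
      ring
    rw [e]
    refine (norm_sub_le _ _).trans ?_
    rw [norm_neg, norm_mul, Complex.norm_real, Real.norm_of_nonneg (by positivity), add_mul]
    refine add_le_add ?_ a3
    refine (mul_le_mul_of_nonneg_left a2 (by positivity)).trans_eq ?_
    rw [abs_mul, abs_neg, abs_of_pos (by positivity : (0 : ℝ) < 1 / N)]
    field_simp
    exact mul_comm _ _
  have t := norm_taylor_le_of_lipschitz d hl le_rfl
  have g0 : g 0 = 0 := by simp [hg, h0]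
  have g0' : g' 0 = 0 := by
    simp only [hg', mul_zero, AddCircle.coe_zero, add_zero, h1]
    push_cast; ring
  rw [g0, g0', mul_zero, sub_zero, sub_zero] at t
  have e : g r = K (z - ((r / N : ℝ) : Torus)) - F (c + r) := by
    simp only [hg]
    congr 2
    rw [sub_eq_add_neg, ← AddCircle.coe_neg]
    congr 2; ring
  rw [← e]
  refine t.trans ?_
  have : 0 ≤ (L / N ^ 2 + E) * r ^ 2 := by positivity
  linarith

theorem norm_conv_sub_le {M : ℕ} (hM : 128 ≤ M) {ε : ℝ≥0} {μ₀ μ : ComplexMeasure Torus}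
    (hμ₀ : IsSeparatedDiscrete M μ₀) (hμ : IsApproximation ε M μ μ₀) {K : Torus → ℂ}
    (hK : TorusDifferentiable K) (hK' : TorusDifferentiable (torusDeriv K))
    (hK'' : MemLp (torusDeriv (torusDeriv K)) ∞ volume) (x₀ : Torus) :
    ‖conv K (μ - μ₀) x₀‖ ≤ 40000 * ε * ((eLpNorm K ∞ volume).toReal
      + (M : ℝ)⁻¹ * (eLpNorm (torusDeriv K) ∞ volume).toReal
      + ((M : ℝ) ^ 2)⁻¹ * (eLpNorm (torusDeriv (torusDeriv K)) ∞ volume).toReal) := by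
  obtain ⟨S, a, hS, ha, rfl⟩ := hμ₀
  set N := (M + 1) / 2 with hNdef
  have hN : 64 ≤ N := by omega
  have hN0 : N ≠ 0 := by omega
  have hNr : (0 : ℝ) < N := by exact_mod_cast Nat.pos_of_ne_zero hN0
  have hMr : (0 : ℝ) < M := by exact_mod_cast (by omega : 0 < M)
  have hMN : (M : ℝ) ≤ 2 * N := by exact_mod_cast (by omega : M ≤ 2 * N)
  have hcK := continuous_of_torusDifferentiable hK
  have hcK' := continuous_of_torusDifferentiable hK'
  have b0 := norm_le_toReal_eLpNorm_top hcK
  have b1 := norm_le_toReal_eLpNorm_top hcK'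
  set L₀ := (eLpNorm K ∞ volume).toReal
  set L₁ := (eLpNorm (torusDeriv K) ∞ volume).toReal
  set L₂ := (eLpNorm (torusDeriv (torusDeriv K)) ∞ volume).toReal with hL₂
  have p0 : 0 ≤ L₀ := ENNReal.toReal_nonneg
  have p1 : 0 ≤ L₁ := ENNReal.toReal_nonneg
  have p2 : 0 ≤ L₂ := ENNReal.toReal_nonneg
  let σ : Torus → ℝ := Function.surjInv QuotientAddGroup.mk_surjective
  have hσ : ∀ s, (σ s : Torus) = s := Function.surjInv_eq QuotientAddGroup.mk_surjective
  have hτ : SepMod N fun j : S => N * σ j :=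
    sepMod_of_minSeparation (by omega) (by omega) hS hσ
  obtain ⟨f, hf, hfS, hfn, hff⟩ := exists_certificate (M := M) hN (by omega) hτ
    (v := fun j : S => (starRingEnd ℂ) (a j) / ‖a j‖) (by
      refine (pi_norm_le_iff_of_nonneg zero_le_one).2 fun j => ?_
      rw [norm_div, RCLike.norm_conj, Complex.norm_real, norm_norm]
      exact div_self_le_one _)
  obtain ⟨T, hT, F, F', F'', hTF, hF, hF', hFv, hFw, hFb, hFb'⟩ :=
    exists_hermite (M := M) hN (by omega) hτ (fun j : S => K (x₀ - j))
      (fun j : S => -(torusDeriv K (x₀ - j) / N))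
  set V : ℝ := ‖fun j : S => K (x₀ - j)‖ + ‖fun j : S => -(torusDeriv K (x₀ - j) / N)‖
  have hV0 : 0 ≤ V := by positivity
  have hV : V ≤ L₀ + L₁ / N := by
    refine add_le_add ((pi_norm_le_iff_of_nonneg p0).2 fun j => b0 _)
      ((pi_norm_le_iff_of_nonneg (by positivity)).2 fun j => ?_)
    rw [norm_neg, norm_div, Complex.norm_natCast]
    exact div_le_div_of_nonneg_right (b1 _) hNr.le
  set d : ℝ := L₂ / N ^ 2 + 2000 * V + 40 * L₀ with hd
  have hd0 : 0 ≤ d := by positivity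
  have dich : ∀ y : Torus, (∃ (j : S) (r : ℝ), |r| ≤ 1 / 5 ∧ y = ((σ j + r / N : ℝ) : Torus)) ∨
      ‖f y‖ ≤ 0.97 := by
    intro y
    obtain ⟨x, rfl⟩ := QuotientAddGroup.mk_surjective y
    by_cases h : ∃ j : S, |red N (N * x - N * σ j)| ≤ 1 / 5
    · obtain ⟨j, hj⟩ := h
      exact Or.inl ⟨j, _, hj, coe_eq_of_red hN0 x (σ j)⟩
    · push Not at h
      exact Or.inr (hff x fun j => (h j).le)
  have hTb : ∀ y, ‖T y‖ ≤ 10 * V := by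
    intro y
    obtain ⟨x, rfl⟩ := QuotientAddGroup.mk_surjective y
    exact (congrArg norm (hTF x)).trans_le (hFb _)
  have main := norm_cintegral_sub_le_of_certificate (φ := fun y => K (x₀ - y)) hμ hf
    (fun y => ?_) (fun s hs => ?_) hT (c := 10 * V) hTb
    (hcK.comp (continuous_const.sub continuous_id)) (fun s hs => ?_) hd0 (fun y => ?_)
  · refine main.trans ?_
    have q1 : L₁ / N ≤ 2 * ((M : ℝ)⁻¹ * L₁) := by
      rw [div_le_iff₀ hNr]
      have : 1 ≤ 2 * (M : ℝ)⁻¹ * N := by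
        rw [mul_right_comm, ← div_eq_mul_inv, le_div_iff₀ hMr]; linarith
      nlinarith
    have q2 : L₂ / N ^ 2 ≤ 4 * (((M : ℝ) ^ 2)⁻¹ * L₂) := by
      rw [div_le_iff₀ (by positivity)]
      have : 1 ≤ 4 * ((M : ℝ) ^ 2)⁻¹ * N ^ 2 := by
        rw [mul_right_comm, ← div_eq_mul_inv, le_div_iff₀ (by positivity)]
        nlinarith
      nlinarith
    have q3 : 0 ≤ (M : ℝ)⁻¹ * L₁ := by positivity
    have q4 : 0 ≤ ((M : ℝ) ^ 2)⁻¹ * L₂ := by positivity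
    have : 2 * (10 * V) + 4 * d ≤ 40000 * (L₀ + (M : ℝ)⁻¹ * L₁ + ((M : ℝ) ^ 2)⁻¹ * L₂) := by
      linarith
    calc _ ≤ 40000 * (L₀ + (M : ℝ)⁻¹ * L₁ + ((M : ℝ) ^ 2)⁻¹ * L₂) * ε :=
          mul_le_mul_of_nonneg_right this ε.coe_nonneg
      _ = _ := by ring
  · rcases dich y with ⟨j, r, hr, rfl⟩ | h
    · linarith [hfn j r hr, sq_nonneg r]
    · linarith
  · have h := hfS ⟨s, hs⟩
    simp only [hσ] at h
    have ha' : (‖a s‖ : ℂ) ≠ 0 := by exact_mod_cast norm_ne_zero_iff.2 (ha s hs)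
    rw [h, div_mul_eq_mul_div, mul_comm, Complex.mul_conj', div_eq_iff ha']
    ring
  · have h1 := hTF (σ s)
    have h2 := hFv ⟨s, hs⟩
    rw [hσ] at h1
    rw [h1]
    exact h2.symm
  · rcases dich y with ⟨j, r, hr, rfl⟩ | h
    · have h1 := norm_sub_hermite_le (Nat.pos_of_ne_zero hN0) hK hK' hK'' hF hF' hFb'
        (hFv j) (hFw j) r
      have e1 : x₀ - ((σ j + r / N : ℝ) : Torus) = x₀ - j - ((r / N : ℝ) : Torus) := by
        rw [AddCircle.coe_add, hσ]; abel
      have e2 : (N : ℝ) * (σ j + r / N) = N * σ j + r := by field_simp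
      rw [e1, hTF, e2]
      refine h1.trans ?_
      rw [← hL₂]
      have h2 : r ^ 2 ≤ 1 - ‖f ((σ j + r / N : ℝ) : Torus)‖ := by linarith [hfn j r hr]
      exact mul_le_mul (by linarith) h2 (sq_nonneg r) hd0
    · have h1 : ‖K (x₀ - y) - T y‖ ≤ L₀ + 10 * V :=
        (norm_sub_le _ _).trans (add_le_add (b0 _) (hTb y))
      have h2 : 0 ≤ L₂ / N ^ 2 := by positivity
      have h3 : d * 0.03 ≤ d * (1 - ‖f y‖) := mul_le_mul_of_nonneg_left (by linarith) hd0
      linarith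

end SuperResolution

end

theorem theorem1 :
    ∃ C : ℝ≥0, 0 < C ∧
      ∀ (M : ℕ), 128 ≤ M →
      ∀ (ε : ℝ≥0) (μ₀ μ : ComplexMeasure SuperResolution.Torus),
        SuperResolution.IsSeparatedDiscrete M μ₀ →
        SuperResolution.IsApproximation ε M μ μ₀ →
      ∀ K : SuperResolution.Torus → ℂ,
        SuperResolution.TorusDifferentiable K →
        SuperResolution.TorusDifferentiable (SuperResolution.torusDeriv K) →
        MemLp (SuperResolution.torusDeriv (SuperResolution.torusDeriv K)) ∞ volume →
        eLpNorm (SuperResolution.conv K (μ - μ₀)) ∞ volume ≤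
          (C : ℝ≥0∞) * (ε : ℝ≥0∞) *
            (eLpNorm K ∞ volume
              + (M : ℝ≥0∞)⁻¹ * eLpNorm (SuperResolution.torusDeriv K) ∞ volume
              + ((M : ℝ≥0∞) ^ 2)⁻¹ *
                eLpNorm (SuperResolution.torusDeriv (SuperResolution.torusDeriv K)) ∞ volume) := by
  refine ⟨40000, by norm_num, fun M hM ε μ₀ μ hμ₀ hμ K hK hK' hK'' => ?_⟩
  have f0 := SuperResolution.eLpNorm_top_ne_top
    (SuperResolution.continuous_of_torusDifferentiable hK)
  have f1 := SuperResolution.eLpNorm_top_ne_top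
    (SuperResolution.continuous_of_torusDifferentiable hK')
  have f2 := hK''.2.ne
  have hM0 : (0 : ℝ) < M := by exact_mod_cast (by omega : 0 < M)
  refine (eLpNormEssSup_le_of_ae_bound (Filter.Eventually.of_forall
    (SuperResolution.norm_conv_sub_le hM hμ₀ hμ hK hK' hK''))).trans_eq ?_
  rw [ENNReal.ofReal_mul (by positivity), ENNReal.ofReal_mul (by norm_num),
    ENNReal.ofReal_add (by positivity) (by positivity),
    ENNReal.ofReal_add (by positivity) (by positivity), ENNReal.ofReal_mul (by positivity),
    ENNReal.ofReal_mul (by positivity), ENNReal.ofReal_toReal f0, ENNReal.ofReal_toReal f1,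
    ENNReal.ofReal_toReal f2, ENNReal.ofReal_inv_of_pos hM0,
    ENNReal.ofReal_inv_of_pos (by positivity), ENNReal.ofReal_pow hM0.le, ENNReal.ofReal_natCast,
    ENNReal.ofReal_coe_nnreal]
  norm_num
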